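/- Let $R$ be a commutative noetherian ring that is Gorenstein (for every prime $\mathfrak p$ the ring $R_{\mathfrak p}$ has finite injective dimension over itself) and not regular (for some prime $\mathfrak p$ the local ring $R_{\mathfrak p}$ is not regular), and let $n\ge 2$ be an integer. Let $\mathcal G$ be the collection of finitely generated Gorenstein projective $R$-modules, i.e. finitely generated modules that are isomorphic to a cokernel of a differential in an exact complex of projective $R$-modules that remains exact under $\operatorname{Hom}_R(-,Q)$ for every projective module $Q$. For a collection $\mathcal C$ of objects of the bounded derived category $\mathsf D^{\mathrm b}_{\mathrm f}(R)$ of complexes with finitely generated homology, let $\operatorname{level}^{\mathcal C}(M)$ be $0$ if $M\cong 0$; be $1$ if $M\not\cong 0$ can be built from $\mathcal C$ by shifts, finite direct sums and direct summands; and in general, for $M \not\cong 0$, be the least $m$ such that $M$ is a direct summand of an object $X$ in an exact triangle $K\to X\to N\to\Sigma K$ with $\operatorname{level}^{\mathcal C}(K)\le 1$ and $\operatorname{level}^{\mathcal C}(N)\le m-1$ (and $\infty$ if there is no such $m$). Then there exists a perfect $R$-complex $P$ (an object isomorphic in the derived category to a bounded complex of finitely generated projective modules) with $$\operatorname{level}^{\{R\}}(P)=n+1\qquad\text{and}\qquad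 \operatorname{level}^{\mathcal G}(P)\le 2 .$$ Moreover, $P$ can be chosen to be a truncated free resolution $$0\to F_n\to\cdots\to F_0\to 0$$ of a module $G$ in $\mathcal G$ that is not projective, where $\cdots\to F_1\to F_0\to G\to 0$ is a resolution of $G$ by finitely generated free $R$-modules. -/

import Mathlib

universe w u

open CategoryTheory CategoryTheory.Limits

/-- A commutative ring is Gorenstein if it is noetherian and its localization at every prime ideal
has finite injective dimension as a module over itself. -/
class IsGorensteinRing (R : Type u) [CommRing R] : Prop extends IsNoetherianRing R where
  injectiveDimension_localization_ne_top (p : Ideal R) [p.IsPrime] :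
    injectiveDimension
      (ModuleCat.of (Localization.AtPrime p) (Localization.AtPrime p)) ≠ ⊤

/-- A totally acyclic complex of projective modules: an exact complex of projective modules which
remains exact under `Hom(-, Q)` for every projective module `Q`. -/
structure IsTotallyAcyclic {R : Type u} [CommRing R]
    (X : CochainComplex (ModuleCat.{u} R) ℤ) : Prop where
  projective (i : ℤ) : Module.Projective R (X.X i)
  acyclic : X.Acyclic
  hom_exact (Q : ModuleCat.{u} R) (_ : Module.Projective R Q) (i : ℤ) (f : X.X (i + 1) ⟶ Q)
    (_ : X.d i (i + 1) ≫ f = 0) :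
    ∃ g : X.X (i + 2) ⟶ Q, f = X.d (i + 1) (i + 2) ≫ g

/-- A module is Gorenstein projective if it is isomorphic to the cokernel of a differential in a
totally acyclic complex of projective modules. -/
def IsGorensteinProjective {R : Type u} [CommRing R] (G : ModuleCat.{u} R) : Prop :=
  ∃ X : CochainComplex (ModuleCat.{u} R) ℤ,
    IsTotallyAcyclic X ∧ Nonempty (G ≅ cokernel (X.d (-1) 0))

section Level

variable {T : Type*} [Category T] [HasZeroObject T] [HasShift T ℤ] [Preadditive T]
  [∀ n : ℤ, (shiftFunctor T n).Additive] [Pretriangulated T]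

open Classical in
/-- The level of an object `M` of a triangulated category with respect to a collection `C` of
objects. It is `0` if `M` is zero. Otherwise it is the least `n + 1` such that `M` lies in
`C.triangEnvelopeIter n`, and `⊤` if there is none. Here `C.triangEnvelopeIter 0` consists of the
objects built from `C` by shifts, finite direct sums and direct summands, while
`C.triangEnvelopeIter (n + 1)` consists of the direct summands of those `X` for which there is a
distinguished triangle `K ⟶ X ⟶ N ⟶ K⟦1⟧` with `K` in `C.triangEnvelopeIter 0` and `N` in
`C.triangEnvelopeIter n`. -/
noncomputable def level (C : ObjectProperty T) (M : T) : ℕ∞ :=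
  if IsZero M then 0 else ⨅ (n : ℕ) (_ : C.triangEnvelopeIter n M), ((n + 1 : ℕ) : ℕ∞)

end Level

section DerivedCategory

variable (R : Type u) [CommRing R] [HasDerivedCategory.{w} (ModuleCat.{u} R)]

/-- The collection `{R}` in the derived category of `R`. -/
def ringCollection : ObjectProperty (DerivedCategory (ModuleCat.{u} R)) :=
  ObjectProperty.singleton
    ((DerivedCategory.singleFunctor (ModuleCat.{u} R) 0).obj (ModuleCat.of R R))

/-- The collection of finitely generated Gorenstein projective modules, regarded as complexes
concentrated in degree `0` in the derived category of `R`. -/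
def gorensteinProjectiveCollection : ObjectProperty (DerivedCategory (ModuleCat.{u} R)) :=
  fun M => ∃ G : ModuleCat.{u} R, Module.Finite R G ∧ IsGorensteinProjective G ∧
    Nonempty (M ≅ (DerivedCategory.singleFunctor (ModuleCat.{u} R) 0).obj G)

variable {R}

/-- A complex is perfect if it is isomorphic in the derived category to a bounded complex of
finitely generated projective modules. -/
def IsPerfectComplex (M : DerivedCategory (ModuleCat.{u} R)) : Prop :=
  ∃ (K : CochainComplex (ModuleCat.{u} R) ℤ) (a b : ℤ),
    K.IsStrictlyGE a ∧ K.IsStrictlyLE b ∧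
    (∀ i, Module.Projective R (K.X i) ∧ Module.Finite R (K.X i)) ∧
    Nonempty (M ≅ DerivedCategory.Q.obj K)

end DerivedCategory

/-- The truncated resolution `0 ⟶ F_n ⟶ ⋯ ⟶ F_0 ⟶ 0`, with `F_i` in cohomological degree `-i`. -/
noncomputable def truncatedResolution {R : Type u} [CommRing R] {G : ModuleCat.{u} R}
    (F : ProjectiveResolution G) (n : ℕ) : CochainComplex (ModuleCat.{u} R) ℤ :=
  F.cochainComplex.stupidTrunc (ComplexShape.embeddingUpIntGE (-(n : ℤ)))

/-! The complex is the truncated free resolution `P` of a suitable `G`. For `n ≥ 1` its only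
homology is `G` in degree `0` and the syzygy `S (n + 1)` in degree `-n`, so the truncation triangle
`S (n + 1)⟦n⟧ ⟶ P ⟶ G` bounds the Gorenstein level by 2, while the `n + 1` free terms bound the
`R`-level by `n + 1`.

The lower bound is the ghost lemma. The classes of `0 → S (i + 1) → F_i → S i → 0` give maps `S i⟦i⟧
⟶ S (i + 1)⟦i + 1⟧` that are invisible to shifts of `R`. If `P` had level at most `n`, the composite
of `P ⟶ G` with `n` of them would vanish. The Yoneda product in `Ext^n(G, S n)` would then factor
through a map of negative degree and be zero. But `Ext^i(G, F) = 0` for `i > 0` and `F` finite free,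
together with `G` not being projective, makes it nonzero (`yonedaProduct_ne_zero`).

It remains to find `G`. By Serre's theorem some `R ⧸ p` has infinite projective dimension, hence so
do all its syzygies. `R` may have infinite Krull dimension, so no uniform bound on local injective
dimensions is available; still `Ext^i(M, R) = 0` for `i` large depending on the finitely generated
`M` (`LocallyExtTorsion.extEventuallyZero`, by Noetherian induction and Koszul complexes). High
syzygies of `R ⧸ p` therefore have no positive `Ext` into `R`, and over a Gorenstein ring such
modules are Gorenstein projective (`VanishingExt.isGorensteinProjective`). -/

open Abelian

/-! ### Torsion of Ext modules along short exact sequences -/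

section ExtTorsion

variable {R : Type u} [CommRing R]

/-- Every element of `Ext N Y i` is annihilated by an element of `S`. -/
def ExtTorsion (S : Submonoid R) (N Y : ModuleCat.{u} R) (i : ℕ) : Prop :=
  ∀ e : Ext N Y i, ∃ s ∈ S, s • e = 0

namespace ExtTorsion

variable {S : Submonoid R} {Y : ModuleCat.{u} R} {i : ℕ}

lemma of_subsingleton {N : ModuleCat.{u} R} (h : Subsingleton (Ext N Y i)) :
    ExtTorsion S N Y i :=
  fun _ => ⟨1, S.one_mem, Subsingleton.elim _ _⟩

lemma subsingleton {N : ModuleCat.{u} R} (h : ExtTorsion ⊥ N Y i) : Subsingleton (Ext N Y i) := by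
  refine subsingleton_of_forall_eq 0 fun e => ?_
  obtain ⟨s, hs, he⟩ := h e
  rw [Submonoid.mem_bot] at hs
  simpa [hs] using he

lemma of_projective {N : ModuleCat.{u} R} [Projective N] : ExtTorsion S N Y (i + 1) :=
  of_subsingleton (Ext.subsingleton_of_projective _ _ _)

lemma of_smul_eq_zero {N : ModuleCat.{u} R} {s : R} (hs : s ∈ S) (h : ∀ x : N, s • x = 0) :
    ExtTorsion S N Y i := fun e => by
  refine ⟨s, hs, ?_⟩
  have : s • 𝟙 N = 0 := by ext x; exact h x
  rw [← Ext.mk₀_id_comp e, ← Ext.smul_comp, ← Ext.mk₀_smul, this, Ext.mk₀_zero, Ext.zero_comp]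

lemma of_iso {N N' : ModuleCat.{u} R} (φ : N ≅ N') (h : ExtTorsion S N Y i) :
    ExtTorsion S N' Y i := fun e => by
  obtain ⟨s, hs, he⟩ := h ((Ext.mk₀ φ.hom).comp e (zero_add i))
  refine ⟨s, hs, ?_⟩
  have := congrArg (fun x => (Ext.mk₀ φ.inv).comp x (zero_add i)) he
  simpa [← Ext.comp_smul] using this

variable {T : ShortComplex (ModuleCat.{u} R)} (hT : T.ShortExact)
include hT

/-- Here and in the next two lemmas, torsion passes to a term of the long exact sequence from its
two neighbours, the annihilators being multiplied. -/
lemma middle (h₁ : ExtTorsion S T.X₁ Y i) (h₃ : ExtTorsion S T.X₃ Y i) :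
    ExtTorsion S T.X₂ Y i := fun e => by
  obtain ⟨s, hs, he⟩ := h₁ ((Ext.mk₀ T.f).comp e (zero_add i))
  rw [← Ext.comp_smul] at he
  obtain ⟨e', he'⟩ := Ext.contravariant_sequence_exact₂ hT Y _ he
  obtain ⟨t, ht, h⟩ := h₃ e'
  refine ⟨t * s, S.mul_mem ht hs, ?_⟩
  rw [mul_smul, ← he', ← Ext.comp_smul, h, Ext.comp_zero]

lemma right (h₁ : ExtTorsion S T.X₁ Y i) (h₂ : ExtTorsion S T.X₂ Y (i + 1)) :
    ExtTorsion S T.X₃ Y (i + 1) := fun e => by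
  obtain ⟨s, hs, he⟩ := h₂ ((Ext.mk₀ T.g).comp e (zero_add _))
  rw [← Ext.comp_smul] at he
  obtain ⟨e', he'⟩ := Ext.contravariant_sequence_exact₃ hT Y _ he (add_comm 1 i)
  obtain ⟨t, ht, h⟩ := h₁ e'
  refine ⟨t * s, S.mul_mem ht hs, ?_⟩
  rw [mul_smul, ← he', ← Ext.comp_smul, h, Ext.comp_zero]

lemma left (h₂ : ExtTorsion S T.X₂ Y i) (h₃ : ExtTorsion S T.X₃ Y (i + 1)) :
    ExtTorsion S T.X₁ Y i := fun e => by
  obtain ⟨s, hs, he⟩ := h₃ (hT.extClass.comp e (add_comm 1 i))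
  rw [← Ext.comp_smul] at he
  obtain ⟨e', he'⟩ := Ext.contravariant_sequence_exact₁ hT Y _ (add_comm 1 i) he
  obtain ⟨t, ht, h⟩ := h₂ e'
  refine ⟨t * s, S.mul_mem ht hs, ?_⟩
  rw [mul_smul, ← he', ← Ext.comp_smul, h, Ext.comp_zero]

end ExtTorsion

end ExtTorsion

section LinearMaps

variable {R : Type u} [CommRing R] {A B C : Type u} [AddCommGroup A] [AddCommGroup B]
  [AddCommGroup C] [Module R A] [Module R B] [Module R C]

/-- The short complex given by two composable linear maps which form an exact sequence. -/
abbrev exactShortComplex (f : A →ₗ[R] B) (g : B →ₗ[R] C) (h : Function.Exact f g) :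
    ShortComplex (ModuleCat.{u} R) :=
  ModuleCat.shortComplexOfCompEqZero f g h.linearMap_comp_eq_zero

lemma exactShortComplex_shortExact {f : A →ₗ[R] B} {g : B →ₗ[R] C} (h : Function.Exact f g)
    (hf : Function.Injective f) (hg : Function.Surjective g) :
    (exactShortComplex f g h).ShortExact :=
  ModuleCat.shortComplex_shortExact _ h hf hg

end LinearMaps

/-! ### Injective dimension under restriction of scalars from a localization -/

section Localization

variable {R : Type u} [CommRing R]

/-- A localization, with scalars restricted to the base ring. -/
def restrictScalarsLocalizationEquiv (S : Submonoid R) :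
    ((ModuleCat.restrictScalars.{u} (algebraMap R (Localization S))).obj
      (ModuleCat.of (Localization S) (Localization S))) ≃ₗ[R] Localization S where
  toFun x := x
  invFun x := x
  map_add' _ _ := rfl
  map_smul' r x := (Algebra.smul_def (A := Localization S) r x).symm
  left_inv _ := rfl
  right_inv _ := rfl

/-- Restriction of scalars is right adjoint to extension of scalars, which preserves monomorphisms
because a localization is flat. -/
instance restrictScalars_localization_preservesInjectiveObjects (S : Submonoid R) :
    (ModuleCat.restrictScalars.{u} (algebraMap R (Localization S))).PreservesInjectiveObjects := by
  have : (ModuleCat.extendScalars.{u} (algebraMap R (Localization S))).PreservesMonomorphisms := by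
    constructor
    intro X Y f hf
    rw [ModuleCat.mono_iff_injective] at hf ⊢
    let L : ModuleCat R := (ModuleCat.restrictScalars.{u} (algebraMap R (Localization S))).obj
      (ModuleCat.of (Localization S) (Localization S))
    have : Module.Flat R L :=
      Module.Flat.of_linearEquiv (N := L) (M := Localization S) (restrictScalarsLocalizationEquiv S)
    exact Module.Flat.lTensor_preserves_injective_linearMap (M := L) f.hom hf
  exact Functor.preservesInjectiveObjects_of_adjunction_of_preservesMonomorphisms
    (ModuleCat.extendRestrictScalarsAdj (algebraMap R (Localization S)))

lemma hasInjectiveDimensionLT_restrictScalars_localization (S : Submonoid R) (n : ℕ)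
    (M : ModuleCat.{u} (Localization S)) (h : HasInjectiveDimensionLT M n) :
    HasInjectiveDimensionLT
      ((ModuleCat.restrictScalars.{u} (algebraMap R (Localization S))).obj M) n := by
  let F := ModuleCat.restrictScalars.{u} (algebraMap R (Localization S))
  obtain _ | n := n
  · rw [hasInjectiveDimensionLT_zero_iff_isZero] at h ⊢
    exact F.map_isZero h
  induction n generalizing M with
  | zero =>
    have : Injective M := injective_iff_hasInjectiveDimensionLT_one.2 h
    have : Injective (F.obj M) := inferInstance
    exact inferInstanceAs (HasInjectiveDimensionLT (F.obj M) 1)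
  | succ n ih =>
    let T : ShortComplex (ModuleCat.{u} (Localization S)) :=
      ShortComplex.mk (Injective.ι M) (cokernel.π (Injective.ι M)) (by simp)
    have hT : T.ShortExact :=
      { exact := ShortComplex.exact_cokernel _ }
    have hT' := hT.map_of_exact F
    have h₃ := (hT.hasInjectiveDimensionLT_X₃_iff n (inferInstanceAs (Injective (Injective.under M)))).2 h
    exact (hT'.hasInjectiveDimensionLT_X₃_iff n
      (inferInstanceAs (Injective (F.obj (Injective.under M))))).1 (ih _ h₃)

end Localization

/-! ### Ext into `R` is locally torsion in high degrees -/

section LocalVanishing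

variable {R : Type u} [CommRing R] [IsNoetherianRing R]

lemma exists_finite_free_shortExact (N : ModuleCat.{u} R) [Module.Finite R N] :
    ∃ T : ShortComplex (ModuleCat.{u} R), T.ShortExact ∧ Module.Finite R T.X₁ ∧
      Module.Finite R T.X₂ ∧ Module.Free R T.X₂ ∧ T.X₃ = N := by
  obtain ⟨n, f, hf⟩ := Module.Finite.exists_fin' R N
  exact ⟨_, LinearMap.shortExact_shortComplexKer hf,
    inferInstanceAs (Module.Finite R (LinearMap.ker f)),
    inferInstanceAs (Module.Finite R (Fin n → R)),
    inferInstanceAs (Module.Free R (Fin n → R)), rfl⟩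

/-- This is the injectivity of `Ext(N, R)_p ⟶ Ext(N, R_p)`, proved by dimension shifting along
finite free presentations. -/
lemma extTorsion_of_comp_localization_eq_zero (p : Ideal R) [p.IsPrime] (N : ModuleCat.{u} R)
    [Module.Finite R N] (i : ℕ) (e : Ext N (ModuleCat.of R R) i)
    (he : e.comp (Ext.mk₀ (ModuleCat.ofHom (Algebra.linearMap R (Localization.AtPrime p))))
      (add_zero i) = 0) : ∃ s ∈ p.primeCompl, s • e = 0 := by
  let l := ModuleCat.ofHom (Algebra.linearMap R (Localization.AtPrime p))
  have key : ∀ (M : ModuleCat.{u} R) [Module.Finite R M] (f : M →ₗ[R] R)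
      (_ : ∀ x, algebraMap R (Localization.AtPrime p) (f x) = 0),
      ∃ s ∈ p.primeCompl, s • f = 0 := by
    intro M _ f hf
    obtain ⟨t, ht⟩ := Module.Finite.fg_top (R := R) (M := M)
    have : ∀ x : M, ∃ s : p.primeCompl, (s : R) * f x = 0 := fun x => by
      simpa using (IsLocalization.map_eq_zero_iff p.primeCompl (Localization.AtPrime p) (f x)).1
        (hf x)
    choose s hs using this
    refine ⟨∏ x ∈ t, (s x : R), Submonoid.prod_mem _ fun x _ => (s x).2, ?_⟩
    refine LinearMap.ext_on ht fun x hx => ?_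
    obtain ⟨c, hc⟩ := Finset.dvd_prod_of_mem (fun x => (s x : R)) hx
    simp only [LinearMap.smul_apply, smul_eq_mul, LinearMap.zero_apply, hc]
    rw [mul_right_comm, hs, zero_mul]
  induction i generalizing N with
  | zero =>
    obtain ⟨f, rfl⟩ := Ext.addEquiv₀.symm.surjective e
    simp only [Ext.addEquiv₀_symm_apply, Ext.mk₀_comp_mk₀] at he ⊢
    have h0 : f ≫ l = 0 := Ext.addEquiv₀.symm.injective (by simpa using he)
    obtain ⟨s, hs, h⟩ := key N f.hom fun x => by
      simpa [l] using congrArg (fun g => g.hom x) h0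
    refine ⟨s, hs, ?_⟩
    rw [← Ext.mk₀_smul]
    have : s • f = 0 := by ext x; simpa using LinearMap.congr_fun h x
    rw [this, Ext.mk₀_zero]
  | succ i ih =>
    obtain ⟨T, hT, h₁, h₂, h₂', rfl⟩ := exists_finite_free_shortExact N
    have : Projective T.X₂ := ModuleCat.projective_of_free (Module.Free.chooseBasis R T.X₂)
    obtain ⟨e', rfl⟩ := Ext.contravariant_sequence_exact₃ hT _ e
      (Ext.eq_zero_of_projective _) (add_comm 1 i)
    rw [Ext.comp_assoc_of_third_deg_zero] at he
    obtain ⟨g, hg⟩ := Ext.contravariant_sequence_exact₁ hT _ _ (add_comm 1 i) he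
    obtain _ | i := i
    · obtain ⟨f, rfl⟩ := Ext.addEquiv₀.symm.surjective e'
      obtain ⟨g, rfl⟩ := Ext.addEquiv₀.symm.surjective g
      simp only [Ext.addEquiv₀_symm_apply, Ext.mk₀_comp_mk₀] at hg he ⊢
      have h0 : T.f ≫ g = f ≫ l := Ext.addEquiv₀.symm.injective (by simpa using hg)
      -- In degree 1 the vanishing gives an extension `g` of `f` with values in `R_p`. Clearing
      -- denominators on a basis turns `s • g` into a map `g'` to `R`. It agrees with `s • f` on
      -- `T.X₁` up to a map that dies in `R_p`, and `key` kills that map.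
      let b := Module.Free.chooseBasis R T.X₂
      obtain ⟨s, hs⟩ := IsLocalization.exist_integer_multiples_of_finite p.primeCompl
        (S := Localization.AtPrime p) (fun j => g.hom (b j))
      choose c hc using hs
      let g' : T.X₂ →ₗ[R] R := b.constr R c
      have hg' : ∀ x, algebraMap R (Localization.AtPrime p) (g' x) = (s : R) • g.hom x := by
        intro x
        have : (Algebra.linearMap R (Localization.AtPrime p)) ∘ₗ g' = (s : R) • g.hom := by
          refine b.ext fun j => ?_
          simp [g', hc]
        exact LinearMap.congr_fun this x
      obtain ⟨t, ht, h⟩ := key T.X₁ ((s : R) • f.hom - g' ∘ₗ T.f.hom) fun x => by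
        have := congrArg (fun g => g.hom x) h0
        simp only [ModuleCat.hom_comp, LinearMap.comp_apply] at this
        simp only [LinearMap.sub_apply, LinearMap.smul_apply, LinearMap.comp_apply, map_sub, hg',
          this]
        simp [l, Algebra.smul_def]
      refine ⟨t * s, mul_mem ht s.2, ?_⟩
      have : (t * s : R) • f = T.f ≫ (t • ModuleCat.ofHom g') := by
        ext x
        have := LinearMap.congr_fun h x
        simp only [LinearMap.sub_apply, LinearMap.smul_apply, LinearMap.comp_apply, smul_sub,
          LinearMap.zero_apply, sub_eq_zero, smul_smul] at this
        simpa using this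
      rw [← Ext.comp_smul, ← Ext.mk₀_smul, this, ← Ext.mk₀_comp_mk₀]
      exact hT.extClass_comp_assoc _
    · have hz : g = 0 := Ext.eq_zero_of_projective _
      rw [hz, Ext.comp_zero] at hg
      obtain ⟨s, hs, h⟩ := ih T.X₁ e' hg.symm
      exact ⟨s, hs, by rw [← Ext.comp_smul, h, Ext.comp_zero]⟩

lemma extTorsion_primeCompl (p : Ideal R) [p.IsPrime] (n : ℕ)
    (h : HasInjectiveDimensionLT
      (ModuleCat.of (Localization.AtPrime p) (Localization.AtPrime p)) n)
    (N : ModuleCat.{u} R) [Module.Finite R N] (i : ℕ) (hi : n ≤ i) :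
    ExtTorsion p.primeCompl N (ModuleCat.of R R) i := fun e => by
  have h' := hasInjectiveDimensionLT_restrictScalars_localization _ _ _ h
  have : HasInjectiveDimensionLT (ModuleCat.of R (Localization.AtPrime p)) n :=
    hasInjectiveDimensionLT_of_iso
      (restrictScalarsLocalizationEquiv p.primeCompl).toModuleIso n
  exact extTorsion_of_comp_localization_eq_zero p N i e
    (Ext.eq_zero_of_hasInjectiveDimensionLT _ n hi)

end LocalVanishing

/-! ### Koszul complexes as iterated cones -/

section Koszul

variable {R : Type u} [CommRing R]

/-- A bounded complex of finite free modules `⋯ → K 1 → K 0` with `K 0 = R` and `H_0 = R ⧸ I`, on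
which all elements of `I` act null-homotopically. -/
structure KoszulData (I : Ideal R) where
  K : ℕ → ModuleCat.{u} R
  d (j : ℕ) : K (j + 1) →ₗ[R] K j
  free (j : ℕ) : Module.Free R (K j)
  finite (j : ℕ) : Module.Finite R (K j)
  d_d (j : ℕ) (x : K (j + 2)) : d j (d (j + 1) x) = 0
  length : ℕ
  subsingleton (j : ℕ) (hj : length < j) : Subsingleton (K j)
  aug : K 0 ≃ₗ[R] R
  mem_range (x : K 0) : x ∈ LinearMap.range (d 0) ↔ aug x ∈ I
  homotopy (y : R) (hy : y ∈ I) : ∃ h : ∀ j, K j →ₗ[R] K (j + 1),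
    (∀ x, d 0 (h 0 x) = y • x) ∧
    ∀ j x, d (j + 1) (h (j + 1) x) + h j (d j x) = y • x

namespace KoszulData

/-- The Koszul complex of the empty family. -/
def bot : KoszulData (⊥ : Ideal R) where
  K j := match j with
    | 0 => ModuleCat.of R R
    | _ + 1 => ModuleCat.of R PUnit.{u + 1}
  d _ := 0
  free j := match j with
    | 0 => inferInstanceAs (Module.Free R R)
    | _ + 1 => inferInstanceAs (Module.Free R PUnit.{u + 1})
  finite j := match j with
    | 0 => inferInstanceAs (Module.Finite R R)
    | _ + 1 => inferInstanceAs (Module.Finite R PUnit.{u + 1})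
  d_d _ _ := rfl
  length := 0
  subsingleton j hj := match j with
    | 0 => absurd hj (lt_irrefl _)
    | _ + 1 => inferInstanceAs (Subsingleton PUnit.{u + 1})
  aug := LinearEquiv.refl R R
  mem_range x := by
    simp only [LinearMap.range_zero, Submodule.mem_bot]
    rfl
  homotopy y hy := by
    rw [Submodule.mem_bot] at hy
    exact ⟨fun _ => 0, fun x => by simp [hy], fun j x => by simp [hy]⟩

variable {I : Ideal R} (D : KoszulData I)

/-- The terms of the cone of an endomorphism of a complex. -/
def coneK : ℕ → ModuleCat.{u} R
  | 0 => D.K 0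
  | j + 1 => ModuleCat.of R (D.K (j + 1) × D.K j)

/-- The differential of the cone of multiplication by `x`. -/
def coneD (x : R) : ∀ j, D.coneK (j + 1) →ₗ[R] D.coneK j
  | 0 => (D.d 0).coprod (x • LinearMap.id)
  | j + 1 => ((D.d (j + 1)).coprod (x • LinearMap.id)).prod (-(D.d j ∘ₗ LinearMap.snd R _ _))

/-- The Koszul complex of a family with one more element, as a cone. -/
def cone (x : R) : KoszulData (I ⊔ Ideal.span {x}) where
  K := D.coneK
  d := D.coneD x
  free j := match j with
    | 0 => D.free 0
    | j + 1 => by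
      have := D.free j
      have := D.free (j + 1)
      exact inferInstanceAs (Module.Free R (D.K (j + 1) × D.K j))
  finite j := match j with
    | 0 => D.finite 0
    | j + 1 => by
      have := D.finite j
      have := D.finite (j + 1)
      exact inferInstanceAs (Module.Finite R (D.K (j + 1) × D.K j))
  d_d j := match j with
    | 0 => by
      rintro ⟨a, b⟩
      change D.d 0 (D.d 1 a + x • b) + x • (-(D.d 0 b)) = 0
      simp [D.d_d]
    | j + 1 => by
      rintro ⟨a, b⟩
      change (D.d (j + 1) (D.d (j + 2) a + x • b) + x • (-(D.d (j + 1) b)),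
        -(D.d j (-(D.d (j + 1) b)))) = 0
      simp [D.d_d]
  length := D.length + 1
  subsingleton j hj := match j with
    | 0 => absurd hj (by lia)
    | j + 1 => by
      have := D.subsingleton j (by lia)
      have := D.subsingleton (j + 1) (by lia)
      exact inferInstanceAs (Subsingleton (D.K (j + 1) × D.K j))
  aug := D.aug
  mem_range z := by
    rw [Submodule.mem_sup]
    constructor
    · rintro ⟨⟨a, b⟩, rfl⟩
      refine ⟨D.aug (D.d 0 a), (D.mem_range _).1 ⟨a, rfl⟩, x * D.aug b,
        Ideal.mul_mem_right _ _ (Ideal.mem_span_singleton_self x), ?_⟩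
      change _ = D.aug (D.d 0 a + x • b)
      simp
    · rintro ⟨y, hy, w, hw, h⟩
      obtain ⟨c, rfl⟩ := Ideal.mem_span_singleton'.1 hw
      obtain ⟨a, ha⟩ := (D.mem_range (D.aug.symm y)).2 (by simpa using hy)
      refine ⟨(a, D.aug.symm c), ?_⟩
      change D.d 0 a + x • D.aug.symm c = z
      apply D.aug.injective
      rw [ha]
      simp only [map_add, map_smul, LinearEquiv.apply_symm_apply, smul_eq_mul, mul_comm x]
      exact h
  homotopy y hy := by
    obtain ⟨w, hw, v, hv, rfl⟩ := Submodule.mem_sup.1 hy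
    obtain ⟨c, rfl⟩ := Ideal.mem_span_singleton'.1 hv
    obtain ⟨h, h0, hs⟩ := D.homotopy w hw
    -- For `w + c * x`, the old homotopy for `w` is combined with `c` times the inclusion into the
    -- shifted copy. The sign in the second component matches the sign in `coneD`.
    refine ⟨fun j => match j with
      | 0 => (h 0).prod (c • LinearMap.id)
      | j + 1 => (h (j + 1) ∘ₗ LinearMap.fst R _ _).prod
          (c • LinearMap.fst R _ _ - h j ∘ₗ LinearMap.snd R _ _), fun (a : D.K 0) => ?_, fun j => ?_⟩
    · change D.d 0 (h 0 a) + x • c • a = (w + c * x) • a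
      rw [h0, add_smul, mul_comm, mul_smul]
    · match j with
      | 0 =>
        rintro ⟨a, b⟩
        change (D.d 1 (h 1 a) + x • (c • a - h 0 b), -(D.d 0 (c • a - h 0 b))) +
          (h 0 (D.d 0 a + x • b), c • (D.d 0 a + x • b)) = (_ • a, _ • b)
        have h1 := hs 0 a
        have h2 := h0 b
        simp only [map_sub, map_add, map_smul, Prod.mk_add_mk, Prod.mk.injEq, h2]
        constructor
        · rw [add_smul, ← h1]; module
        · module
      | j + 1 =>
        rintro ⟨a, b⟩
        change (D.d (j + 2) (h (j + 2) a) + x • (c • a - h (j + 1) b),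
            -(D.d (j + 1) (c • a - h (j + 1) b))) +
          (h (j + 1) (D.d (j + 1) a + x • b), c • (D.d (j + 1) a + x • b) - h j (-(D.d j b)))
            = (_ • a, _ • b)
        have h1 := hs (j + 1) a
        have h2 := hs j b
        simp only [map_sub, map_add, map_smul, map_neg, Prod.mk_add_mk, Prod.mk.injEq]
        constructor
        · rw [add_smul, ← h1]; module
        · rw [add_smul, ← h2]; module

lemma nonempty_of_fg (I : Ideal R) (hI : I.FG) : Nonempty (KoszulData I) := by
  classical
  obtain ⟨s, rfl⟩ := hI
  induction s using Finset.induction with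
  | empty => exact ⟨by simpa using bot⟩
  | insert x s _ ih =>
    obtain ⟨D⟩ := ih
    have : Ideal.span ((insert x s : Finset R) : Set R) = Ideal.span s ⊔ Ideal.span {x} := by
      rw [Finset.coe_insert, Ideal.span_insert, sup_comm]
    exact ⟨this ▸ D.cone x⟩

/-- The cycles in degree `j + 1`. -/
abbrev cycles (j : ℕ) : Submodule R (D.K (j + 1)) := LinearMap.ker (D.d j)

/-- The boundaries in degree `j + 1`, as a submodule of the cycles. -/
abbrev boundaries (j : ℕ) : Submodule R (D.cycles j) :=
  (LinearMap.range (D.d (j + 1))).comap (D.cycles j).subtype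

/-- The homology in degree `j + 1`. -/
abbrev homology (j : ℕ) : Type u := D.cycles j ⧸ D.boundaries j

lemma smul_homology {y : R} (hy : y ∈ I) (j : ℕ) (x : D.homology j) : y • x = 0 := by
  obtain ⟨h, -, hs⟩ := D.homotopy y hy
  obtain ⟨⟨x, hx⟩, rfl⟩ := Submodule.mkQ_surjective _ x
  rw [← map_smul, Submodule.mkQ_apply, Submodule.Quotient.mk_eq_zero]
  refine ⟨h (j + 1) x, ?_⟩
  have := hs j x
  rw [LinearMap.mem_ker.1 hx, map_zero, add_zero] at this
  exact this

section Torsion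

variable {S : Submonoid R} {Y : ModuleCat.{u} R}

lemma projective (j : ℕ) : Projective (D.K j) := by
  have := D.free j
  exact ModuleCat.projective_of_free (Module.Free.chooseBasis R (D.K j))

lemma extTorsion_boundaries (j i : ℕ)
    (h : ExtTorsion S (ModuleCat.of R (D.cycles (j + 1))) Y i) :
    ExtTorsion S (ModuleCat.of R (D.boundaries j)) Y (i + 1) := by
  let f : D.K (j + 2) →ₗ[R] D.boundaries j :=
    ((D.d (j + 1)).codRestrict (D.cycles j) fun x => D.d_d j x).codRestrict (D.boundaries j)
      fun x => ⟨x, rfl⟩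
  have hf : Function.Surjective f := by
    rintro ⟨⟨x, hx⟩, ⟨y, hy⟩⟩
    exact ⟨y, Subtype.ext (Subtype.ext hy)⟩
  have hex : Function.Exact (D.cycles (j + 1)).subtype f := fun x => by
    rw [Subtype.ext_iff, Subtype.ext_iff]
    exact ⟨fun hx => ⟨⟨x, hx⟩, rfl⟩, by rintro ⟨x, rfl⟩; exact x.2⟩
  have := D.projective (j + 2)
  exact ExtTorsion.right
    (exactShortComplex_shortExact hex (Submodule.subtype_injective _) hf)
    h (ExtTorsion.of_projective (N := D.K (j + 2)))

/-- Descent from the top of the complex, where the cycles vanish. Each step down crosses `K (j + 2)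
→ boundaries`, which costs one Ext degree, hence the bound `a + t ≤ i`. -/
lemma extTorsion_cycles {a b : ℕ}
    (h : ∀ j i, a ≤ i → i ≤ b → ExtTorsion S (ModuleCat.of R (D.homology j)) Y i) (t j i : ℕ)
    (hj : D.length ≤ j + t) (hi : a + t ≤ i) (hi' : i ≤ b) :
    ExtTorsion S (ModuleCat.of R (D.cycles j)) Y i := by
  induction t generalizing j i with
  | zero =>
    have := D.subsingleton (j + 1) (by lia)
    exact ExtTorsion.of_smul_eq_zero S.one_mem fun x => Subsingleton.elim (α := D.cycles j) _ _
  | succ t ih =>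
    obtain _ | i := i
    · lia
    have hex : Function.Exact (D.boundaries j).subtype (D.boundaries j).mkQ :=
      LinearMap.exact_subtype_mkQ _
    exact ExtTorsion.middle
      (exactShortComplex_shortExact hex (Submodule.subtype_injective _)
        (Submodule.mkQ_surjective _))
      (D.extTorsion_boundaries j i (ih (j + 1) i (by lia) (by lia) (by lia)))
      (h j (i + 1) (by lia) hi')

/-- Torsion for the Koszul homology in degrees up to `b` controls `R ⧸ I` in degree `b + 2`. This
gain in degree drives the induction in `LocallyExtTorsion.exists_powers`. -/
lemma extTorsion_quotient {a b : ℕ}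
    (h : ∀ j i, a ≤ i → i ≤ b → ExtTorsion S (ModuleCat.of R (D.homology j)) Y i)
    (hab : a + D.length ≤ b) : ExtTorsion S (ModuleCat.of R (R ⧸ I)) Y (b + 2) := by
  have h₁ := D.extTorsion_cycles h D.length 0 b (by lia) hab le_rfl
  have hex₁ : Function.Exact (D.cycles 0).subtype (D.d 0).rangeRestrict := fun x => by
    rw [Subtype.ext_iff]
    exact ⟨fun hx => ⟨⟨x, hx⟩, rfl⟩, by rintro ⟨x, rfl⟩; exact x.2⟩
  have := D.projective 1
  have := D.projective 0
  have h₂ := ExtTorsion.right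
    (exactShortComplex_shortExact hex₁ (Submodule.subtype_injective _)
      (LinearMap.surjective_rangeRestrict _)) h₁ (ExtTorsion.of_projective (N := D.K 1))
  have hex₂ : Function.Exact (LinearMap.range (D.d 0)).subtype
      (Submodule.mkQ I ∘ₗ D.aug.toLinearMap) := fun x => by
    exact (Submodule.Quotient.mk_eq_zero I).trans ((D.mem_range x).symm.trans (by simp))
  exact ExtTorsion.right
    (exactShortComplex_shortExact hex₂ (Submodule.subtype_injective _)
      ((Submodule.mkQ_surjective I).comp D.aug.surjective)) h₂
      (ExtTorsion.of_projective (N := D.K 0))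

end Torsion

end KoszulData

end Koszul

/-! ### Eventual vanishing of Ext without a bound on the dimension -/

section EventualVanishing

variable {R : Type u} [CommRing R] [IsNoetherianRing R]

/-- A prime filtration of `N` has factors `R ⧸ q` and `R ⧸ p` with `p` strictly larger. An element
of `p` outside `q` kills the latter, and `f₀` collects these elements, independently of `i`. -/
lemma exists_forall_extTorsion_powers_of_smul_eq_zero (Y : ModuleCat.{u} R) (q : Ideal R)
    [hq : q.IsPrime] (N : Type u) [AddCommGroup N] [Module R N] [Module.Finite R N]
    (hN : ∀ y ∈ q, ∀ x : N, y • x = 0) :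
    ∃ f₀ ∉ q, ∀ f, f₀ ∣ f → ∀ i,
      ExtTorsion (Submonoid.powers f) (ModuleCat.of R (R ⧸ q)) Y i →
      ExtTorsion (Submonoid.powers f) (ModuleCat.of R N) Y i := by
  revert hN
  refine IsNoetherianRing.induction_on_isQuotientEquivQuotientPrime R (M := N) inferInstance
    (motive := fun N _ _ _ => (∀ y ∈ q, ∀ x : N, y • x = 0) →
      ∃ f₀ ∉ q, ∀ f, f₀ ∣ f → ∀ i,
      ExtTorsion (Submonoid.powers f) (ModuleCat.of R (R ⧸ q)) Y i →
      ExtTorsion (Submonoid.powers f) (ModuleCat.of R N) Y i) ?_ ?_ ?_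
  · intro N _ _ _ _ _
    exact ⟨1, q.one_notMem, fun f _ i _ => ExtTorsion.of_smul_eq_zero (Submonoid.one_mem _)
      fun x => Subsingleton.elim (α := N) _ _⟩
  · intro N _ _ _ p e hN
    have hqp : q ≤ p.1 := fun y hy => by
      have := congrArg e (hN y hy (e.symm (Submodule.Quotient.mk 1)))
      rw [map_smul, e.apply_symm_apply, map_zero, ← Submodule.Quotient.mk_smul,
        Submodule.Quotient.mk_eq_zero] at this
      simpa using this
    by_cases hpq : p.1 ≤ q
    · obtain rfl : q = p.1 := le_antisymm hqp hpq
      exact ⟨1, p.1.one_notMem, fun f _ i h => h.of_iso e.symm.toModuleIso⟩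
    · obtain ⟨f₀, hf₀, hf₀'⟩ := SetLike.not_le_iff_exists.1 hpq
      refine ⟨f₀, hf₀', fun f hf i _ => ExtTorsion.of_smul_eq_zero
        (Submonoid.mem_powers f) fun (x : N) => e.injective ?_⟩
      obtain ⟨y, hy⟩ := Submodule.Quotient.mk_surjective _ (e x)
      rw [map_smul, map_zero, ← hy, ← Submodule.Quotient.mk_smul, Submodule.Quotient.mk_eq_zero]
      exact Ideal.mul_mem_right _ _ (Ideal.mem_of_dvd _ hf hf₀)
  · intro N₁ _ _ _ N₂ _ _ _ N₃ _ _ _ f g hf hg hfg h₁ h₃ hN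
    obtain ⟨a, ha, h₁⟩ := h₁ fun y hy x => hf (by rw [map_smul, hN y hy, map_zero])
    obtain ⟨b, hb, h₃⟩ := h₃ fun y hy x => by
      obtain ⟨x, rfl⟩ := hg x
      rw [← map_smul, hN y hy, map_zero]
    refine ⟨a * b, fun h => (hq.mem_or_mem h).elim ha hb, fun c hc i h => ?_⟩
    exact ExtTorsion.middle (exactShortComplex_shortExact hfg hf hg)
      (h₁ c ((dvd_mul_right a b).trans hc) i h) (h₃ c ((dvd_mul_left b a).trans hc) i h)

/-- The Ext module is finitely generated, so the annihilators of its generators multiply to a common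
one. -/
lemma ExtTorsion.exists_forall_smul_eq_zero {S : Submonoid R} {N Y : ModuleCat.{u} R}
    [Module.Finite R N] [Module.Finite R Y] {i : ℕ} (h : ExtTorsion S N Y i) :
    ∃ s ∈ S, ∀ e : Ext N Y i, s • e = 0 := by
  obtain ⟨t, ht⟩ := Module.Finite.fg_top (R := R) (M := Ext N Y i)
  choose s hs hs' using h
  refine ⟨∏ x ∈ t, s x, Submonoid.prod_mem _ fun x _ => hs x, ?_⟩
  suffices LinearMap.lsmul R (Ext N Y i) (∏ x ∈ t, s x) = 0 from
    fun e => LinearMap.congr_fun this e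
  refine LinearMap.ext_on ht fun x hx => ?_
  obtain ⟨c, hc⟩ := Finset.dvd_prod_of_mem s hx
  simp [hc, mul_comm (s x), mul_smul, hs']

/-- Eventual vanishing of `Ext N Y`. -/
def ExtEventuallyZero (N Y : ModuleCat.{u} R) : Prop :=
  ∃ n, ∀ i, n ≤ i → Subsingleton (Ext N Y i)

lemma extEventuallyZero_of_forall_prime (Y : ModuleCat.{u} R) (J : Ideal R)
    (h : ∀ p : Ideal R, p.IsPrime → J ≤ p → ExtEventuallyZero (ModuleCat.of R (R ⧸ p)) Y)
    (N : Type u) [AddCommGroup N] [Module R N] [Module.Finite R N]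
    (hN : ∀ y ∈ J, ∀ x : N, y • x = 0) : ExtEventuallyZero (ModuleCat.of R N) Y := by
  revert hN
  refine IsNoetherianRing.induction_on_isQuotientEquivQuotientPrime R (M := N) inferInstance
    (motive := fun N _ _ _ => (∀ y ∈ J, ∀ x : N, y • x = 0) →
      ExtEventuallyZero (ModuleCat.of R N) Y) ?_ ?_ ?_
  · intro N _ _ _ _ _
    exact ⟨0, fun i _ => (ExtTorsion.of_smul_eq_zero (s := 1) (Submonoid.one_mem _)
      fun x => Subsingleton.elim (α := N) _ _).subsingleton⟩
  · intro N _ _ _ p e hN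
    have hJp : J ≤ p.1 := fun y hy => by
      have := congrArg e (hN y hy (e.symm (Submodule.Quotient.mk 1)))
      rw [map_smul, e.apply_symm_apply, map_zero, ← Submodule.Quotient.mk_smul,
        Submodule.Quotient.mk_eq_zero] at this
      simpa using this
    obtain ⟨n, hn⟩ := h p.1 p.2 hJp
    exact ⟨n, fun i hi =>
      ((ExtTorsion.of_subsingleton (hn i hi)).of_iso e.symm.toModuleIso).subsingleton⟩
  · intro N₁ _ _ _ N₂ _ _ _ N₃ _ _ _ f g hf hg hfg h₁ h₃ hN
    obtain ⟨a, h₁⟩ := h₁ fun y hy x => hf (by rw [map_smul, hN y hy, map_zero])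
    obtain ⟨b, h₃⟩ := h₃ fun y hy x => by
      obtain ⟨x, rfl⟩ := hg x
      rw [← map_smul, hN y hy, map_zero]
    refine ⟨max a b, fun i hi => (ExtTorsion.middle
      (exactShortComplex_shortExact hfg hf hg)
      (.of_subsingleton (h₁ i (by lia))) (.of_subsingleton (h₃ i (by lia)))).subsingleton⟩

/-- A module is locally of finite injective dimension, in terms of its `Ext`-modules. -/
def LocallyExtTorsion (Y : ModuleCat.{u} R) : Prop :=
  ∀ (p : Ideal R) [p.IsPrime], ∃ n, ∀ (N : ModuleCat.{u} R) [Module.Finite R N] (i : ℕ), n ≤ i →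
    ExtTorsion p.primeCompl N Y i

/-- One `f` serves infinitely many degrees: it is chosen for a finite window, and the Koszul complex
on `q`, whose homology is killed by `q`, propagates torsion upwards from there. -/
lemma LocallyExtTorsion.exists_powers {Y : ModuleCat.{u} R} [Module.Finite R Y]
    (hY : LocallyExtTorsion Y) (q : Ideal R) [hq : q.IsPrime] :
    ∃ f ∉ q, ∃ a, ∀ i, a ≤ i →
      ExtTorsion (Submonoid.powers f) (ModuleCat.of R (R ⧸ q)) Y i := by
  obtain ⟨D⟩ := KoszulData.nonempty_of_fg q (IsNoetherian.noetherian q)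
  obtain ⟨a, ha⟩ := hY q
  have hfin : ∀ j, Module.Finite R (D.homology j) := fun j => by
    have := D.finite (j + 1)
    infer_instance
  choose f₀ hf₀ hf₀' using fun j => exists_forall_extTorsion_powers_of_smul_eq_zero Y q
    (D.homology j) fun y hy => D.smul_homology hy j
  choose s hs hs' using fun i : {i // a ≤ i} =>
    (ha (ModuleCat.of R (R ⧸ q)) i.1 i.2).exists_forall_smul_eq_zero
  -- The first factor handles the Koszul homology modules, the second kills Ext in the `D.length +
  -- 2` initial degrees not reached by `extTorsion_quotient`.
  let f := (∏ j ∈ Finset.range D.length, f₀ j) *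
    ∏ k ∈ Finset.range (D.length + 2), s ⟨a + k, by lia⟩
  refine ⟨f, ?_, a, fun i => ?_⟩
  · exact q.primeCompl.mul_mem (Submonoid.prod_mem _ fun j _ => hf₀ j)
      (Submonoid.prod_mem _ fun k _ => hs _)
  induction i using Nat.strong_induction_on with
  | _ i ih =>
  intro hi
  by_cases hi' : i < a + (D.length + 2)
  · obtain ⟨k, rfl⟩ := Nat.exists_eq_add_of_le hi
    obtain ⟨c, hc⟩ : s ⟨a + k, by lia⟩ ∣ f := (Finset.dvd_prod_of_mem
      (fun k => s ⟨a + k, by lia⟩) (Finset.mem_range.2 (by lia))).trans (dvd_mul_left _ _)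
    refine fun e => ⟨f, Submonoid.mem_powers f, ?_⟩
    rw [hc, mul_comm, mul_smul, hs' ⟨a + k, by lia⟩ e, smul_zero]
  · obtain ⟨b, rfl⟩ : ∃ b, i = b + 2 := ⟨i - 2, by lia⟩
    refine D.extTorsion_quotient (a := a) (fun j i h₁ h₂ => ?_) (by lia)
    by_cases hj : j < D.length
    · exact hf₀' j f ((Finset.dvd_prod_of_mem f₀ (Finset.mem_range.2 hj)).trans
        (dvd_mul_right _ _)) i (ih i (by lia) h₁)
    · have := D.subsingleton (j + 1) (by lia)
      exact ExtTorsion.of_smul_eq_zero (Submonoid.one_mem _)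
        fun x => Subsingleton.elim (α := D.homology j) _ _

/-- Noetherian induction on primes `q`. The cokernel of `f` on `R ⧸ q` is supported on larger
primes, so `f` is eventually injective on `Ext^i(R ⧸ q, Y)`. That module is also `f`-power torsion,
hence zero. -/
theorem LocallyExtTorsion.extEventuallyZero {Y : ModuleCat.{u} R} [Module.Finite R Y]
    (hY : LocallyExtTorsion Y) (M : ModuleCat.{u} R) [Module.Finite R M] :
    ExtEventuallyZero M Y := by
  suffices h : ∀ q : Ideal R, q.IsPrime → ExtEventuallyZero (ModuleCat.of R (R ⧸ q)) Y from
    extEventuallyZero_of_forall_prime Y ⊥ (fun p hp _ => h p hp) M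
      (fun y hy x => by rw [(Submodule.mem_bot R).1 hy, zero_smul])
  intro q
  induction q using IsNoetherian.induction with
  | hgt q ih =>
  intro hq
  obtain ⟨f, hf, a, ha⟩ := hY.exists_powers q
  let μ : (R ⧸ q) →ₗ[R] R ⧸ q := LinearMap.lsmul R (R ⧸ q) f
  have hμ : Function.Injective μ := by
    rw [injective_iff_map_eq_zero]
    intro x hx
    obtain ⟨x, rfl⟩ := Submodule.Quotient.mk_surjective _ x
    rw [LinearMap.lsmul_apply, ← Submodule.Quotient.mk_smul, Submodule.Quotient.mk_eq_zero] at hx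
    rw [Submodule.Quotient.mk_eq_zero]
    exact (hq.mem_or_mem hx).resolve_left hf
  have hex : Function.Exact μ (LinearMap.range μ).mkQ := LinearMap.exact_map_mkQ_range _
  have hT := exactShortComplex_shortExact hex hμ (Submodule.mkQ_surjective _)
  have hlt : q < q ⊔ Ideal.span {f} := by
    refine lt_of_le_of_ne le_sup_left fun h => hf ?_
    rw [h]
    exact Ideal.mem_sup_right (Ideal.mem_span_singleton_self f)
  obtain ⟨b, hb⟩ := extEventuallyZero_of_forall_prime Y (q ⊔ Ideal.span {f})
    (fun p hp hqp => ih p (lt_of_lt_of_le hlt hqp) hp) ((R ⧸ q) ⧸ LinearMap.range μ) (by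
      intro y hy x
      obtain ⟨x, rfl⟩ := Submodule.mkQ_surjective _ x
      obtain ⟨w, hw, v, hv, rfl⟩ := Submodule.mem_sup.1 hy
      obtain ⟨c, rfl⟩ := Ideal.mem_span_singleton'.1 hv
      have : w • x = 0 := by
        obtain ⟨x, rfl⟩ := Submodule.Quotient.mk_surjective _ x
        rw [← Submodule.Quotient.mk_smul, Submodule.Quotient.mk_eq_zero]
        exact Ideal.mul_mem_right _ _ hw
      rw [← map_smul, add_smul, this, zero_add, Submodule.mkQ_apply, Submodule.Quotient.mk_eq_zero]
      exact ⟨c • x, by rw [LinearMap.lsmul_apply, ← mul_smul, mul_comm]⟩)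
  refine ⟨max a b, fun i hi => subsingleton_of_forall_eq 0 fun e => ?_⟩
  have hinj : ∀ e : Ext (ModuleCat.of R (R ⧸ q)) Y i, f • e = 0 → e = 0 := fun e he => by
    have hμe : (Ext.mk₀ (ModuleCat.ofHom μ)).comp e (zero_add i) = 0 := by
      have : ModuleCat.ofHom μ = f • 𝟙 (ModuleCat.of R (R ⧸ q)) := rfl
      rw [this, Ext.mk₀_smul, Ext.smul_comp, Ext.mk₀_id_comp, he]
    obtain ⟨e', rfl⟩ := Ext.contravariant_sequence_exact₂ hT Y e hμe
    have := hb i (by lia)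
    rw [Subsingleton.elim e' 0, Ext.comp_zero]
  obtain ⟨s, ⟨k, rfl⟩, hk⟩ := ha i (by lia) e
  clear hi
  induction k with
  | zero => simpa using hk
  | succ k ihk =>
    refine ihk (hinj _ ?_)
    simpa [pow_succ', mul_smul] using hk

end EventualVanishing

/-! ### First Ext and extension of maps -/

section ExtOne

variable {R : Type u} [CommRing R]

lemma exists_extension_of_subsingleton_ext_one {A B C : ModuleCat.{u} R} {f : A ⟶ B} {g : B ⟶ C}
    {w : f ≫ g = 0} (h : (ShortComplex.mk f g w).ShortExact) {Y : ModuleCat.{u} R}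
    (hC : Subsingleton (Ext C Y 1)) (φ : A ⟶ Y) : ∃ ψ : B ⟶ Y, f ≫ ψ = φ := by
  obtain ⟨e, he⟩ := Ext.contravariant_sequence_exact₁ h Y (Ext.mk₀ φ) (add_zero 1)
    (Subsingleton.elim (α := Ext C Y 1) _ _)
  obtain ⟨ψ, rfl⟩ := Ext.addEquiv₀.symm.surjective e
  exact ⟨ψ, Ext.addEquiv₀.symm.injective (by simpa using he)⟩

lemma subsingleton_ext_one_of_exists_extension {A B C : ModuleCat.{u} R} {f : A ⟶ B} {g : B ⟶ C}
    {w : f ≫ g = 0} (h : (ShortComplex.mk f g w).ShortExact) {Y : ModuleCat.{u} R} [Projective B]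
    (hA : ∀ φ : A ⟶ Y, ∃ ψ : B ⟶ Y, f ≫ ψ = φ) : Subsingleton (Ext C Y 1) := by
  refine subsingleton_of_forall_eq 0 fun e => ?_
  obtain ⟨x, rfl⟩ := Ext.contravariant_sequence_exact₃ h Y e
    (Ext.eq_zero_of_projective (P := B) _) (add_zero 1)
  obtain ⟨φ, rfl⟩ := Ext.addEquiv₀.symm.surjective x
  obtain ⟨ψ, rfl⟩ := hA φ
  rw [Ext.addEquiv₀_symm_apply, ← Ext.mk₀_comp_mk₀]
  exact h.extClass_comp_assoc _

end ExtOne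

/-! ### Duality for modules with no higher Ext into `R` -/

section VanishingExt

variable {R : Type u} [CommRing R]

/-- The finitely generated modules `G` with `Ext^i(G, R) = 0` for all `i > 0`. -/
structure VanishingExt (G : ModuleCat.{u} R) : Prop where
  finite : Module.Finite R G
  subsingleton (i : ℕ) : Subsingleton (Ext G (ModuleCat.of R R) (i + 1))

/-- `B` is the quotient of a finite free module by a submodule isomorphic to `A`. -/
structure FreeExtension (A B : ModuleCat.{u} R) where
  F : ModuleCat.{u} R
  ι : A ⟶ F
  π : F ⟶ B
  zero : ι ≫ π = 0
  shortExact : (ShortComplex.mk ι π zero).ShortExact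
  free : Module.Free R F
  finite : Module.Finite R F

namespace FreeExtension

variable {A B : ModuleCat.{u} R} (E : FreeExtension A B)

lemma projective : Projective E.F := by
  have := E.free
  exact ModuleCat.projective_of_free (Module.Free.chooseBasis R E.F)

lemma injective_ι : Function.Injective E.ι.hom :=
  (ModuleCat.mono_iff_injective _).1 E.shortExact.mono_f

lemma surjective_π : Function.Surjective E.π.hom :=
  (ModuleCat.epi_iff_surjective _).1 E.shortExact.epi_g

lemma exact : Function.Exact E.ι.hom E.π.hom :=
  (ShortComplex.ShortExact.moduleCat_exact_iff_function_exact _).1 E.shortExact.exact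

include E in
lemma finite_left [IsNoetherianRing R] : Module.Finite R A := by
  have := E.finite
  exact Module.Finite.of_injective E.ι.hom E.injective_ι

include E in
lemma vanishingExt_left [IsNoetherianRing R] (hB : VanishingExt B) : VanishingExt A where
  finite := E.finite_left
  subsingleton i := by
    have := E.projective
    exact (ExtTorsion.left E.shortExact (ExtTorsion.of_projective (N := E.F))
      (ExtTorsion.of_subsingleton (hB.subsingleton (i + 1)))).subsingleton

/-- The dual exact sequence. -/
lemma dual_exact : Function.Exact E.π.hom.dualMap E.ι.hom.dualMap := fun φ => by
  constructor
  · intro hφ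
    have hker : LinearMap.ker E.π.hom ≤ LinearMap.ker φ := fun x hx => by
      obtain ⟨a, rfl⟩ := (E.exact x).1 hx
      exact LinearMap.congr_fun hφ a
    refine ⟨(LinearMap.ker E.π.hom).liftQ φ hker ∘ₗ
      (E.π.hom.quotKerEquivOfSurjective E.surjective_π).symm.toLinearMap, ?_⟩
    ext x
    simp only [LinearMap.dualMap_apply, LinearMap.comp_apply, LinearEquiv.coe_coe]
    rw [show E.π.hom x = E.π.hom.quotKerEquivOfSurjective E.surjective_π
      (Submodule.Quotient.mk x) from rfl, LinearEquiv.symm_apply_apply, Submodule.liftQ_apply]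
  · rintro ⟨ψ, rfl⟩
    ext x
    have : E.π.hom (E.ι.hom x) = 0 := (E.exact _).2 ⟨x, rfl⟩
    simp [LinearMap.dualMap_apply, this]

lemma dual_injective : Function.Injective E.π.hom.dualMap :=
  LinearMap.dualMap_injective_of_surjective E.surjective_π

lemma dual_surjective (hB : VanishingExt B) : Function.Surjective E.ι.hom.dualMap := fun φ => by
  obtain ⟨ψ, hψ⟩ := exists_extension_of_subsingleton_ext_one E.shortExact (hB.subsingleton 0)
    (ModuleCat.ofHom φ)
  exact ⟨ψ.hom, LinearMap.ext fun x => congrArg (fun f => f.hom x) hψ⟩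

end FreeExtension

lemma exists_freeExtension_left (B : ModuleCat.{u} R) [Module.Finite R B] :
    ∃ A, Nonempty (FreeExtension A B) := by
  obtain ⟨n, f, hf⟩ := Module.Finite.exists_fin' R B
  exact ⟨_, ⟨{
    F := ModuleCat.of R (Fin n → R)
    ι := ModuleCat.ofHom (LinearMap.ker f).subtype
    π := ModuleCat.ofHom f
    zero := by ext x; exact x.2
    shortExact := LinearMap.shortExact_shortComplexKer hf
    free := inferInstanceAs (Module.Free R (Fin n → R))
    finite := inferInstanceAs (Module.Finite R (Fin n → R)) }⟩⟩

lemma finite_dual [IsNoetherianRing R] (G : ModuleCat.{u} R) [Module.Finite R G] :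
    Module.Finite R (Module.Dual R G) := by
  obtain ⟨A, ⟨E⟩⟩ := exists_freeExtension_left G
  have := E.free
  have := E.finite
  exact Module.Finite.of_injective E.π.hom.dualMap E.dual_injective

variable [IsNoetherianRing R]

lemma VanishingExt.exists_left {B : ModuleCat.{u} R} (hB : VanishingExt B) :
    ∃ A, VanishingExt A ∧ Nonempty (FreeExtension A B) := by
  have := hB.finite
  obtain ⟨A, ⟨E⟩⟩ := exists_freeExtension_left B
  exact ⟨A, E.vanishingExt_left hB, ⟨E⟩⟩

namespace VanishingExt

variable (hR : LocallyExtTorsion (ModuleCat.of R R))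
include hR

/-- The dual of `0 → G₁ → F → G → 0` stays exact, so `G*` is a syzygy of `G₁*`. Passing to further
syzygies raises the Ext degree until the local bound `n` applies. -/
lemma extTorsion_dual (p : Ideal R) [p.IsPrime] {G : ModuleCat.{u} R} (hG : VanishingExt G)
    (j : ℕ) : ExtTorsion p.primeCompl (ModuleCat.of R (Module.Dual R G)) (ModuleCat.of R R)
      (j + 1) := by
  obtain ⟨n, hn⟩ := hR p
  suffices h : ∀ (m j : ℕ) (_ : n ≤ j + 1 + m) (G : ModuleCat.{u} R) (_ : VanishingExt G),
      ExtTorsion p.primeCompl (ModuleCat.of R (Module.Dual R G)) (ModuleCat.of R R) (j + 1) from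
    h n j (by lia) G hG
  intro m
  induction m with
  | zero =>
    intro j hj G hG
    have := hG.finite
    have : Module.Finite R (ModuleCat.of R (Module.Dual R G)) := finite_dual G
    exact hn (ModuleCat.of R (Module.Dual R G)) (j + 1) hj
  | succ m ih =>
    intro j hj G hG
    obtain ⟨G₁, hG₁, ⟨E⟩⟩ := hG.exists_left
    have := E.free
    have := E.finite
    have : Projective (ModuleCat.of R (Module.Dual R E.F)) :=
      ModuleCat.projective_of_free (Module.Free.chooseBasis R (Module.Dual R E.F))
    exact ExtTorsion.left
      (exactShortComplex_shortExact E.dual_exact E.dual_injective (E.dual_surjective hG))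
      (ExtTorsion.of_projective (N := ModuleCat.of R (Module.Dual R E.F)))
      (ih (j + 1) (by lia) G₁ hG₁)

/-- The annihilator of a class lies in no maximal ideal, so it is the unit ideal. -/
lemma subsingleton_ext_dual {G : ModuleCat.{u} R} (hG : VanishingExt G) :
    Subsingleton (Ext (ModuleCat.of R (Module.Dual R G)) (ModuleCat.of R R) 1) := by
  refine subsingleton_of_forall_eq 0 fun e => ?_
  suffices h : LinearMap.ker (LinearMap.toSpanSingleton R _ e) = ⊤ by
    have : (1 : R) ∈ LinearMap.ker (LinearMap.toSpanSingleton R _ e) := h ▸ Submodule.mem_top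
    simpa using this
  by_contra h
  obtain ⟨m, hm, hle⟩ := Ideal.exists_le_maximal _ h
  have := hm.isPrime
  obtain ⟨s, hs, hse⟩ := hG.extTorsion_dual hR m 0 e
  exact hs (hle (by simpa using hse))

/-- `G` is torsionless. Lift `g` to `y` in `F`; evaluation at `y` kills `G*`, so it induces `θ` on
`G₁*`. Since `Ext^1(G₂*, R) = 0`, `θ` extends to `F₁*`, where it is evaluation at some `z`. Hence
`y` is the image of `z` and lies in `G₁`. -/
lemma eq_zero_of_forall_dual {G : ModuleCat.{u} R} (hG : VanishingExt G) (g : G)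
    (hg : ∀ φ : Module.Dual R G, φ g = 0) : g = 0 := by
  obtain ⟨G₁, hG₁, ⟨E⟩⟩ := hG.exists_left
  obtain ⟨G₂, hG₂, ⟨E₁⟩⟩ := hG₁.exists_left
  have := E.free
  have := E.finite
  have := E₁.free
  have := E₁.finite
  obtain ⟨y, rfl⟩ := E.surjective_π g
  let r := E.ι.hom.dualMap
  have hr : Function.Surjective r := E.dual_surjective hG
  have hker : LinearMap.ker r ≤ LinearMap.ker (Module.Dual.eval R E.F y) := fun φ hφ => by
    obtain ⟨ψ, rfl⟩ := (E.dual_exact φ).1 hφ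
    exact hg ψ
  let θ : Module.Dual R G₁ →ₗ[R] R := (LinearMap.ker r).liftQ _ hker ∘ₗ
    (r.quotKerEquivOfSurjective hr).symm.toLinearMap
  have hθ : ∀ φ, θ (r φ) = φ y := fun φ => by
    simp only [θ, LinearMap.comp_apply, LinearEquiv.coe_coe]
    rw [show r φ = r.quotKerEquivOfSurjective hr (Submodule.Quotient.mk φ) from rfl,
      LinearEquiv.symm_apply_apply, Submodule.liftQ_apply, Module.Dual.eval_apply]
  obtain ⟨Θ, hΘ⟩ := exists_extension_of_subsingleton_ext_one
    (exactShortComplex_shortExact E₁.dual_exact E₁.dual_injective (E₁.dual_surjective hG₁))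
    (subsingleton_ext_dual hR hG₂) (ModuleCat.ofHom θ)
  obtain ⟨z, hz⟩ := (Module.evalEquiv R E₁.F).surjective Θ.hom
  have key : ∀ ψ : Module.Dual R E.F, ψ (y - E.ι.hom (E₁.π.hom z)) = 0 := fun ψ => by
    have h₁ : Θ.hom (E₁.π.hom.dualMap (r ψ)) = θ (r ψ) :=
      congrArg (fun f => f.hom (r ψ)) hΘ
    rw [hθ, ← hz] at h₁
    rw [map_sub, ← h₁]
    simp [r, LinearMap.dualMap_apply]
  have h₀ := (Module.forall_dual_apply_eq_zero_iff R _).1 key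
  rw [sub_eq_zero] at h₀
  rw [h₀]
  exact (E.exact _).2 ⟨_, rfl⟩

/-- Generators of `G*` are the coordinates of an embedding of `G` in a finite free module. Every
functional on `G` is a combination of these coordinates and so extends, which is the vanishing of
`Ext^1` of the cokernel. -/
lemma exists_right {G : ModuleCat.{u} R} (hG : VanishingExt G) :
    ∃ B, VanishingExt B ∧ Nonempty (FreeExtension G B) := by
  have := hG.finite
  have := finite_dual G
  obtain ⟨n, c, hc⟩ := Module.Finite.exists_fin' R (Module.Dual R G)
  let e (i : Fin n) : Fin n → R := Pi.single i 1
  let v : G →ₗ[R] Fin n → R := LinearMap.pi fun i => c (e i)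
  have hcv : ∀ a g, c a g = ∑ i, a i * v g i := fun a g => by
    conv_lhs => rw [pi_eq_sum_univ' a]
    simp [v, e]
  have hv : Function.Injective v := by
    rw [injective_iff_map_eq_zero]
    intro g hg
    refine hG.eq_zero_of_forall_dual hR g fun φ => ?_
    obtain ⟨a, rfl⟩ := hc φ
    simp [hcv, hg]
  have hex : Function.Exact v (LinearMap.range v).mkQ := LinearMap.exact_map_mkQ_range _
  let E : FreeExtension G (ModuleCat.of R ((Fin n → R) ⧸ LinearMap.range v)) :=
    { F := ModuleCat.of R (Fin n → R)
      ι := ModuleCat.ofHom v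
      π := ModuleCat.ofHom (LinearMap.range v).mkQ
      zero := (exactShortComplex v _ hex).zero
      shortExact := exactShortComplex_shortExact hex hv (Submodule.mkQ_surjective _)
      free := inferInstanceAs (Module.Free R (Fin n → R))
      finite := inferInstanceAs (Module.Finite R (Fin n → R)) }
  have := E.projective
  refine ⟨_, ⟨inferInstanceAs (Module.Finite R ((Fin n → R) ⧸ LinearMap.range v)), fun i => ?_⟩,
    ⟨E⟩⟩
  obtain _ | i := i
  · refine subsingleton_ext_one_of_exists_extension E.shortExact fun φ => ?_
    obtain ⟨a, ha⟩ := hc φ.hom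
    refine ⟨ModuleCat.ofHom (∑ i, a i • LinearMap.proj i), ?_⟩
    ext g
    change (∑ i, a i • LinearMap.proj i : (Fin n → R) →ₗ[R] R) (v g) = φ.hom g
    rw [← ha, hcv]
    simp
  · exact (ExtTorsion.right E.shortExact (ExtTorsion.of_subsingleton (hG.subsingleton i))
      (ExtTorsion.of_projective (N := E.F))).subsingleton

end VanishingExt

end VanishingExt

/-! ### Totally acyclic complexes by splicing -/

section TotallyAcyclic

variable {R : Type u} [CommRing R]

/-- `Q` is a retract of a free module, and a map from the finitely generated `A` has only finitely
many nonzero coordinates there. Each coordinate is extended separately. -/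
lemma exists_extension_of_projective {A B C : ModuleCat.{u} R} {f : A ⟶ B} {g : B ⟶ C}
    {w : f ≫ g = 0} (h : (ShortComplex.mk f g w).ShortExact) (hA : Module.Finite R A)
    (hC : Subsingleton (Ext C (ModuleCat.of R R) 1)) (Q : ModuleCat.{u} R)
    (hQ : Module.Projective R Q) (φ : A ⟶ Q) : ∃ ψ : B ⟶ Q, f ≫ ψ = φ := by
  classical
  obtain ⟨s, hs⟩ := hQ.out
  let c : A →ₗ[R] (Q →₀ R) := s ∘ₗ φ.hom
  obtain ⟨t, ht⟩ := Module.Finite.fg_top (R := R) (M := A)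
  let T : Finset Q := t.biUnion fun a => (c a).support
  have hT : ∀ a, ∀ q ∉ T, c a q = 0 := fun a q hq => by
    suffices h : Finsupp.lapply q ∘ₗ c = 0 from LinearMap.congr_fun h a
    refine LinearMap.ext_on ht fun x hx => ?_
    by_contra hne
    exact hq (Finset.mem_biUnion.2 ⟨x, hx, Finsupp.mem_support_iff.2 hne⟩)
  choose ψ hψ using fun q : Q => exists_extension_of_subsingleton_ext_one h hC
    (ModuleCat.ofHom (Finsupp.lapply q ∘ₗ c))
  have hψ' : ∀ q a, (ψ q).hom (f.hom a) = c a q := fun q a =>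
    congrArg (fun f => f.hom a) (hψ q)
  refine ⟨ModuleCat.ofHom (Finsupp.linearCombination R id ∘ₗ
    ∑ q ∈ T, Finsupp.lsingle q ∘ₗ (ψ q).hom), ?_⟩
  ext a
  have hsum : ∑ q ∈ T, Finsupp.single q (c a q) = c a := by
    ext q
    rw [Finsupp.finsetSum_apply]
    by_cases hq : q ∈ T
    · rw [Finset.sum_eq_single q] <;> simp +contextual [hq]
    · rw [hT a q hq, Finset.sum_eq_zero]
      intro x hx
      rw [Finsupp.single_eq_of_ne]
      rintro rfl
      exact hq hx
  have : (Finsupp.linearCombination R id) (c a) = φ.hom a := hs (φ.hom a)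
  rw [← this, ← hsum]
  simp [hψ']

section Splice

variable (C : ℤ → ModuleCat.{u} R) (E : ∀ m, FreeExtension (C m) (C (m + 1)))

/-- The complex obtained by splicing short exact sequences. -/
def splice : CochainComplex (ModuleCat.{u} R) ℤ :=
  CochainComplex.of (fun m => (E m).F) (fun m => (E m).π ≫ (E (m + 1)).ι)
    (fun m => by simp [reassoc_of% (E (m + 1)).zero])

lemma splice_d (m : ℤ) : (splice C E).d m (m + 1) = (E m).π ≫ (E (m + 1)).ι :=
  CochainComplex.of_d (fun m => (E m).F) (fun m => (E m).π ≫ (E (m + 1)).ι) m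

lemma splice_exact (m : ℤ) : Function.Exact ((splice C E).d m (m + 1)).hom
    ((splice C E).d (m + 1) (m + 1 + 1)).hom := fun x => by
  rw [splice_d, splice_d]
  change (E (m + 1 + 1)).ι.hom ((E (m + 1)).π.hom x) = 0 ↔
    ∃ y, (E (m + 1)).ι.hom ((E m).π.hom y) = x
  rw [map_eq_zero_iff _ (E (m + 1 + 1)).injective_ι]
  constructor
  · intro hx
    obtain ⟨c, rfl⟩ := ((E (m + 1)).exact x).1 hx
    obtain ⟨y, rfl⟩ := (E m).surjective_π c
    exact ⟨y, rfl⟩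
  · rintro ⟨y, rfl⟩
    exact ((E (m + 1)).exact _).2 ⟨_, rfl⟩

/-- For `hom_exact`, a map killed by the preceding differential factors through the next `C`, and it
extends along `ι` because `Ext^1` of the cokernel into `R` vanishes. -/
lemma splice_isTotallyAcyclic (hC : ∀ m, VanishingExt (C m)) :
    IsTotallyAcyclic (splice C E) where
  projective m := by
    have := (E m).free
    exact inferInstanceAs (Module.Projective R (E m).F)
  acyclic m := by
    obtain ⟨m, rfl⟩ : ∃ k, m = k + 1 := ⟨m - 1, by ring⟩
    rw [HomologicalComplex.exactAt_iff' _ m (m + 1) (m + 1 + 1) (by simp) (by simp),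
      ShortComplex.ShortExact.moduleCat_exact_iff_function_exact]
    exact splice_exact C E m
  hom_exact Q hQ m f hf := by
    obtain ⟨k, hk⟩ : ∃ k, k = m + 2 := ⟨_, rfl⟩
    rw [← hk]
    obtain rfl : k = m + 1 + 1 := by rw [hk]; ring
    change (E (m + 1)).F ⟶ Q at f
    have := (E m).shortExact.epi_g
    rw [splice_d] at hf ⊢
    have hf' : (E (m + 1)).ι ≫ f = 0 := by
      rw [← cancel_epi (E m).π]
      simpa using! hf
    have : Epi (ShortComplex.mk _ _ (E (m + 1)).zero).g := (E (m + 1)).shortExact.epi_g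
    let φ : C (m + 1 + 1) ⟶ Q := (E (m + 1)).shortExact.exact.desc f hf'
    obtain ⟨ψ, hψ⟩ := exists_extension_of_projective (E (m + 1 + 1)).shortExact
      (hC _).finite ((hC _).subsingleton 0) Q hQ φ
    refine ⟨ψ, ?_⟩
    change f = ((E (m + 1)).π ≫ (E (m + 1 + 1)).ι) ≫ ψ
    rw [Category.assoc, hψ]
    exact ((E (m + 1)).shortExact.exact.g_desc f hf').symm

lemma nonempty_iso_cokernel_splice (i j : ℤ) (h : i + 1 = j) :
    Nonempty (C (j + 1) ≅ cokernel ((splice C E).d i j)) := by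
  subst h
  have := (E i).shortExact.epi_g
  have : Epi (ShortComplex.mk _ _ (E (i + 1)).zero).g := (E (i + 1)).shortExact.epi_g
  rw [splice_d]
  exact ⟨((E (i + 1)).shortExact.gIsCokernel.coconePointUniqueUpToIso
    (cokernelIsCokernel _)) ≪≫ (cokernelEpiComp (E i).π (E (i + 1)).ι).symm⟩

end Splice

lemma exists_int_chain {α : Type*} (r : α → α → Prop) (hl : ∀ b, ∃ a, r a b)
    (hr : ∀ a, ∃ b, r a b) (x : α) : ∃ c : ℤ → α, c 0 = x ∧ ∀ m, r (c m) (c (m + 1)) := by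
  choose f hf using hl
  choose g hg using hr
  refine ⟨fun m => match m with
    | Int.ofNat n => g^[n] x
    | Int.negSucc n => f^[n + 1] x, rfl, fun m => ?_⟩
  match m with
  | Int.ofNat n =>
    change r (g^[n] x) (g^[n + 1] x)
    rw [Function.iterate_succ_apply']
    exact hg _
  | Int.negSucc 0 => exact hf x
  | Int.negSucc (n + 1) =>
    change r (f^[n + 1 + 1] x) (f^[n + 1] x)
    rw [Function.iterate_succ_apply']
    exact hf _

theorem VanishingExt.isGorensteinProjective [IsNoetherianRing R]
    (hR : LocallyExtTorsion (ModuleCat.of R R)) {G : ModuleCat.{u} R} (hG : VanishingExt G) :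
    IsGorensteinProjective G := by
  obtain ⟨c, hc₀, hc⟩ := exists_int_chain (α := {A : ModuleCat.{u} R // VanishingExt A})
    (fun A B => Nonempty (FreeExtension A.1 B.1))
    (fun B => by
      obtain ⟨A, hA, hE⟩ := B.2.exists_left
      exact ⟨⟨A, hA⟩, hE⟩)
    (fun A => by
      obtain ⟨B, hB, hE⟩ := A.2.exists_right hR
      exact ⟨⟨B, hB⟩, hE⟩) ⟨G, hG⟩
  -- The shift by one places `G` at `C 1`, which is the cokernel of the differential from degree
  -- `-1` to degree `0`.
  let C (m : ℤ) : ModuleCat.{u} R := (c (m - 1)).1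
  have hE : ∀ m, Nonempty (FreeExtension (C m) (C (m + 1))) := fun m => by
    have := hc (m - 1)
    rwa [show m - 1 + 1 = m + 1 - 1 by ring] at this
  let E := fun m => (hE m).some
  refine ⟨splice C E, splice_isTotallyAcyclic C E fun m => (c (m - 1)).2, ?_⟩
  obtain ⟨e⟩ := nonempty_iso_cokernel_splice C E (-1) 0 (by simp)
  exact ⟨eqToIso (by simp [C, hc₀]) ≪≫ e⟩

end TotallyAcyclic

/-! ### Serre's theorem: projective dimension, socles and regular elements -/

section Serre

open IsLocalRing

open scoped Pointwise

section QuotSMulTop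

variable {A : Type u} [CommRing A]

/-- A free presentation remains exact modulo `x` because `x` is regular on `M`; its kernel is again
`x`-regular, so induction applies. -/
lemma hasProjectiveDimensionLE_quotSMulTop (x : A) (hx : IsSMulRegular A x) (n : ℕ)
    (M : ModuleCat.{u} A) (hM : IsSMulRegular M x) (h : HasProjectiveDimensionLE M n) :
    HasProjectiveDimensionLE (ModuleCat.of (A ⧸ Ideal.span {x}) (QuotSMulTop x M)) n := by
  induction n generalizing M with
  | zero =>
    have hp := projective_iff_hasProjectiveDimensionLT_one.2 h
    have : Module.Projective A M := (IsProjective.iff_projective M).2 hp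
    have : Module.Projective (A ⧸ Ideal.span {x}) (QuotSMulTop x M) :=
      Module.Projective.of_equiv ((QuotSMulTop.equivQuotTensor x M).extendScalarsOfSurjective
        Ideal.Quotient.mk_surjective).symm
    exact projective_iff_hasProjectiveDimensionLT_one.1
      ((IsProjective.iff_projective (QuotSMulTop x M)).1 this)
  | succ n ih =>
    let b : Module.Basis M A (M →₀ A) := Finsupp.basisSingleOne
    let f : (M →₀ A) →ₗ[A] M := Finsupp.linearCombination A id
    have hf : Function.Surjective f := Finsupp.linearCombination_id_surjective A M
    have hT := LinearMap.shortExact_shortComplexKer hf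
    have hF : Projective (ModuleCat.of A (M →₀ A)) := ModuleCat.projective_of_free b
    have hK := (hT.hasProjectiveDimensionLT_X₃_iff n hF).1 h
    have hFx : IsSMulRegular (M →₀ A) x := fun p q hpq => by
      ext m
      exact hx (DFunLike.congr_fun hpq m)
    have hKx : IsSMulRegular (LinearMap.ker f) x := fun p q hpq =>
      Subtype.ext (hFx (congrArg Subtype.val hpq))
    have ihK := ih (ModuleCat.of A (LinearMap.ker f)) hKx hK
    let surj := Ideal.Quotient.mk_surjective (I := Ideal.span {x})
    let i := (QuotSMulTop.map (M := LinearMap.ker f) (M' := M →₀ A) x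
      (LinearMap.ker f).subtype).extendScalarsOfSurjective surj
    let p := (QuotSMulTop.map x f).extendScalarsOfSurjective surj
    have hex : Function.Exact i p := QuotSMulTop.map_exact x f.exact_subtype_ker_map hf
    have hinj : Function.Injective i := by
      have h₀ : Function.Exact (0 : LinearMap.ker f →ₗ[A] LinearMap.ker f)
          (LinearMap.ker f).subtype := fun y => by
        simp [eq_comm]
      have := QuotSMulTop.map_first_exact_on_four_term_exact_of_isSMulRegular_last
        (M := LinearMap.ker f) (M' := LinearMap.ker f) (M'' := M →₀ A) h₀
        f.exact_subtype_ker_map hM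
      rw [map_zero] at this
      rw [injective_iff_map_eq_zero]
      intro y hy
      obtain ⟨z, hz⟩ := (this y).1 hy
      exact hz.symm
    have hT' := exactShortComplex_shortExact hex hinj (QuotSMulTop.map_surjective x hf)
    have hF' : Projective (ModuleCat.of (A ⧸ Ideal.span {x}) (QuotSMulTop x (M →₀ A))) :=
      ModuleCat.projective_of_free
        (Module.Free.chooseBasis (A ⧸ Ideal.span {x}) (QuotSMulTop x (M →₀ A)))
    exact (hT'.hasProjectiveDimensionLT_X₃_iff n hF').2 ihK

end QuotSMulTop

variable {A : Type u} [CommRing A] [IsLocalRing A]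

/-- In a generating set of least cardinality, a relation with a unit coefficient would make a
generator redundant. -/
lemma exists_minimal_surjection (M : Type u) [AddCommGroup M] [Module A M] [Module.Finite A M] :
    ∃ (s : Finset M) (f : (s → A) →ₗ[A] M), Function.Surjective f ∧
      ∀ x, f x = 0 → ∀ i, x i ∈ maximalIdeal A := by
  classical
  have hex : ∃ n, ∃ s : Finset M, s.card = n ∧ Submodule.span A (s : Set M) = ⊤ := by
    obtain ⟨s, hs⟩ := Module.Finite.fg_top (R := A) (M := M)
    exact ⟨_, s, rfl, hs⟩
  obtain ⟨s, hs, hs'⟩ := Nat.find_spec hex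
  refine ⟨s, Fintype.linearCombination A (fun i : s => (i : M)), ?_, fun x hx i => ?_⟩
  · rw [← LinearMap.range_eq_top, Fintype.range_linearCombination]
    simpa using hs'
  · by_contra hi
    rw [mem_maximalIdeal, mem_nonunits_iff, not_not] at hi
    refine Nat.find_min hex (m := (s.erase i).card) (hs ▸ Finset.card_erase_lt_of_mem i.2)
      ⟨_, rfl, ?_⟩
    rw [eq_top_iff, ← hs', Submodule.span_le]
    have hmem : ∀ j ∈ s, j ≠ i → j ∈ Submodule.span A ((s.erase i : Finset M) : Set M) :=
      fun j hj hji => Submodule.subset_span (by simp [hj, hji])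
    intro j hj
    by_cases hji : j = i
    · rw [Fintype.linearCombination_apply, ← Finset.add_sum_erase _ _ (Finset.mem_univ i)] at hx
      rw [hji, SetLike.mem_coe, ← Submodule.smul_mem_iff_of_isUnit _ hi, eq_neg_of_add_eq_zero_left hx]
      refine neg_mem (Submodule.sum_mem _ fun k hk => Submodule.smul_mem _ _ ?_)
      refine hmem k k.2 fun h => (Finset.mem_erase.1 hk).1 (Subtype.ext h)
    · exact hmem j hj hji

variable [IsNoetherianRing A]

/-- The depth zero case of Auslander–Buchsbaum: the kernel of a minimal presentation is free by
induction, yet lies in the maximal ideal times the free module and so is killed by `a`. Hence it is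
zero. -/
lemma projective_of_hasProjectiveDimensionLE_of_socle {a : A} (ha : a ≠ 0)
    (hm : ∀ m ∈ maximalIdeal A, a * m = 0) (n : ℕ) (M : ModuleCat.{u} A) [Module.Finite A M]
    (h : HasProjectiveDimensionLE M n) : Projective M := by
  induction n generalizing M with
  | zero => exact projective_iff_hasProjectiveDimensionLT_one.2 h
  | succ n ih =>
    obtain ⟨s, f, hf, hmin⟩ := exists_minimal_surjection (A := A) M
    have hT := LinearMap.shortExact_shortComplexKer hf
    have hF : Projective (ModuleCat.of A (s → A)) := ModuleCat.projective_of_free (Pi.basisFun A s)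
    have hK := ih (ModuleCat.of A (LinearMap.ker f)) ((hT.hasProjectiveDimensionLT_X₃_iff n hF).1 h)
    have : Module.Projective A (LinearMap.ker f) := (IsProjective.iff_projective _).2 hK
    have : Module.Free A (LinearMap.ker f) := Module.free_of_flat_of_isLocalRing
    let b := Module.Free.chooseBasis A (LinearMap.ker f)
    have hempty : IsEmpty (Module.Free.ChooseBasisIndex A (LinearMap.ker f)) := ⟨fun i => by
      have h0 : a • b i = 0 := by
        ext j
        exact hm _ (hmin _ (b i).2 j)
      have := congrArg (fun z => b.repr z i) h0
      simp [ha] at this⟩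
    have : Subsingleton (LinearMap.ker f) := b.repr.toEquiv.subsingleton
    have hinj : Function.Injective f := by
      rw [← LinearMap.ker_eq_bot]
      exact Submodule.subsingleton_iff_eq_bot.1 this
    exact Projective.of_iso (LinearEquiv.ofBijective f ⟨hinj, hf⟩).toModuleIso hF

lemma maximalIdeal_eq_bot_of_socle {a : A} (ha : a ≠ 0)
    (hm : ∀ m ∈ maximalIdeal A, a * m = 0) (n : ℕ) (K : ModuleCat.{u} A) [Module.Finite A K]
    (v : K) (hv : v ≠ 0) (hmK : ∀ m ∈ maximalIdeal A, ∀ w : K, m • w = 0)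
    (h : HasProjectiveDimensionLE K n) : maximalIdeal A = ⊥ := by
  have hp := projective_of_hasProjectiveDimensionLE_of_socle ha hm n K h
  have : Module.Projective A K := (IsProjective.iff_projective _).2 hp
  have : Module.Free A K := Module.free_of_flat_of_isLocalRing
  let b := Module.Free.chooseBasis A K
  have : Nontrivial K := ⟨v, 0, hv⟩
  obtain ⟨i⟩ := b.index_nonempty
  refine (Submodule.eq_bot_iff _).2 fun m hm' => ?_
  have := congrArg (fun z => b.repr z i) (hmK m hm' (b i))
  simpa using this

/-- Prime avoidance for the associated primes and the square of the maximal ideal. Nakayama excludes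
the square; an associated prime containing the maximal ideal would give a socle element. -/
lemma exists_regular_notMem_sq
    (hbot : maximalIdeal A ≠ ⊥)
    (hsoc : ∀ a : A, (∀ m ∈ maximalIdeal A, a * m = 0) → a = 0) :
    ∃ x ∈ maximalIdeal A, x ∉ maximalIdeal A ^ 2 ∧ x ∈ nonZeroDivisors A := by
  classical
  have hfin := associatedPrimes.finite A A
  by_contra! hcon
  have hsub : ((maximalIdeal A : Ideal A) : Set A) ⊆
      ⋃ I ∈ (↑(insert (maximalIdeal A ^ 2) hfin.toFinset) : Set (Ideal A)), id I := by
    intro x hx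
    by_cases hx2 : x ∈ maximalIdeal A ^ 2
    · exact Set.mem_biUnion (by simp) hx2
    · have : x ∈ ⋃ p ∈ associatedPrimes A A, (p : Set A) := by
        rw [biUnion_associatedPrimes_eq_compl_nonZeroDivisors]
        exact hcon x hx hx2
      obtain ⟨p, hp, hxp⟩ := Set.mem_iUnion₂.1 this
      exact Set.mem_biUnion (by simp [hp]) hxp
  obtain ⟨I, hI, hle⟩ := (Ideal.subset_union_prime (maximalIdeal A ^ 2) (maximalIdeal A ^ 2)
    (fun I hI h _ => by
      have : I ∈ associatedPrimes A A := by simpa [h] using hI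
      exact this.isPrime)).1 hsub
  rcases Finset.mem_insert.1 hI with rfl | hI
  · refine hbot (Submodule.eq_bot_of_le_smul_of_le_jacobson_bot (maximalIdeal A) _
      (IsNoetherian.noetherian _) ?_ ?_)
    · rw [smul_eq_mul, ← pow_two]; exact hle
    · exact maximalIdeal_le_jacobson _
  · have hI' : IsAssociatedPrime I A := hfin.mem_toFinset.1 hI
    obtain ⟨hp, a, ha⟩ := isAssociatedPrime_iff.1 hI'
    refine hp.ne_top ((Ideal.eq_top_iff_one I).2 ?_)
    have h0 : a = 0 := hsoc a fun m hm => by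
      have : m ∈ (⊥ : Submodule A A).colon {a} := ha ▸ hle hm
      simpa [Submodule.mem_colon_singleton, mul_comm] using this
    rw [ha]
    simp [h0]

end Serre

/-! ### Serre's theorem: induction on the Krull dimension -/

section Serre

open IsLocalRing

open scoped Pointwise

/-- Lifts of generators together with `x` generate the maximal ideal, while the dimension of `A`
exceeds that of the quotient by at least one. -/
lemma isRegularLocalRing_of_quotient {A : Type u} [CommRing A] [IsLocalRing A] [IsNoetherianRing A]
    {x : A} (hx : x ∈ maximalIdeal A) (hx' : x ∈ nonZeroDivisors A)
    (h : IsRegularLocalRing (A ⧸ Ideal.span {x})) : IsRegularLocalRing A := by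
  let π := Ideal.Quotient.mk (Ideal.span {x})
  have hπ : Function.Surjective π := Ideal.Quotient.mk_surjective
  set 𝔫 := maximalIdeal (A ⧸ Ideal.span {x})
  have hfg : 𝔫.FG := 𝔫.fg_of_isNoetherianRing
  have hfin := Submodule.FG.finite_generators hfg
  let σ := Function.surjInv hπ
  have hσ : ∀ b, π (σ b) = b := Function.surjInv_eq hπ
  have hcomap : Ideal.comap π 𝔫 = maximalIdeal A := by
    have : IsLocalHom π := .of_surjective π hπ
    exact IsLocalRing.maximalIdeal_comap π
  have hspan : maximalIdeal A = Submodule.span A (σ '' 𝔫.generators ∪ {x}) := by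
    apply le_antisymm
    · rw [← hcomap]
      intro a ha
      have h1 : Ideal.map π (Ideal.span (σ '' 𝔫.generators)) = 𝔫 := by
        rw [Ideal.map_span, ← Set.image_comp]
        have : π ∘ σ = id := funext hσ
        rw [this, Set.image_id]
        exact 𝔫.span_generators
      have h2 : a ∈ Ideal.comap π (Ideal.map π (Ideal.span (σ '' 𝔫.generators))) := by
        rw [h1]; exact ha
      rw [Ideal.comap_map_of_surjective π hπ] at h2
      rw [Submodule.span_union]
      rwa [← RingHom.ker_eq_comap_bot, Ideal.mk_ker] at h2
    · rw [Submodule.span_le]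
      rintro _ (⟨b, hb, rfl⟩ | rfl)
      · rw [SetLike.mem_coe, ← hcomap, Ideal.mem_comap, hσ, ← 𝔫.span_generators]
        exact Submodule.subset_span hb
      · exact hx
  apply IsRegularLocalRing.of_spanFinrank_maximalIdeal_le
  refine le_trans ?_ (ringKrullDim_quotient_succ_le_of_nonZeroDivisor hx')
  rw [← (isRegularLocalRing_iff _).1 h]
  have : (maximalIdeal A).spanFinrank ≤ 𝔫.spanFinrank + 1 := by
    rw [hspan, ← Submodule.FG.generators_ncard hfg]
    refine (Submodule.spanFinrank_span_le_ncard_of_finite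
      ((hfin.image σ).union (Set.finite_singleton x))).trans ((Set.ncard_union_le _ _).trans ?_)
    rw [Set.ncard_singleton]
    exact Nat.add_le_add_right (Set.ncard_image_le hfin) 1
  exact_mod_cast this

/-- The residue field, as the line spanned by the class of `x`, splits off `𝔪 / x𝔪`: the retraction
comes from a functional on `𝔪 / 𝔪²` with value 1 at `x`. -/
lemma exists_retract_quotSMulTop_maximalIdeal {A : Type u} [CommRing A] [IsLocalRing A] {x : A}
    (hx : x ∈ maximalIdeal A) (hx2 : x ∉ maximalIdeal A ^ 2) :
    ∃ (v : QuotSMulTop x (maximalIdeal A))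
      (r : QuotSMulTop x (maximalIdeal A) →ₗ[A ⧸ Ideal.span {x}]
        Submodule.span (A ⧸ Ideal.span {x}) {v}),
      v ≠ 0 ∧ (∀ m ∈ maximalIdeal A, Ideal.Quotient.mk (Ideal.span {x}) m • v = 0) ∧
      ∀ w : Submodule.span (A ⧸ Ideal.span {x}) {v}, r w = w := by
  let q : maximalIdeal A →ₗ[A] QuotSMulTop x (maximalIdeal A) := Submodule.mkQ _
  let x' : maximalIdeal A := ⟨x, hx⟩
  have hmv : ∀ m ∈ maximalIdeal A, m • q x' = 0 := fun m hm => by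
    rw [← map_smul]
    refine (Submodule.Quotient.mk_eq_zero _).2 ?_
    refine Submodule.mem_smul_pointwise_iff_exists _ _ _ |>.2 ⟨⟨m, hm⟩, trivial, ?_⟩
    exact Subtype.ext (mul_comm _ _)
  have hcot : (maximalIdeal A).toCotangent x' ≠ 0 := fun h =>
    hx2 ((Ideal.toCotangent_eq_zero _ _).1 h)
  obtain ⟨f, hf⟩ := Module.Projective.exists_dual_eq_one (ResidueField A)
    (V := CotangentSpace A) hcot
  let g : ResidueField A →ₗ[A] QuotSMulTop x (maximalIdeal A) :=
    Submodule.liftQ (maximalIdeal A) (LinearMap.toSpanSingleton A _ (q x')) fun m hm => hmv m hm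
  let φ : maximalIdeal A →ₗ[A] QuotSMulTop x (maximalIdeal A) :=
    g ∘ₗ f.restrictScalars A ∘ₗ (maximalIdeal A).toCotangent
  have hφ : φ x' = q x' := by
    change g (f _) = _
    rw [hf]
    exact one_smul A (q x')
  let ψ : QuotSMulTop x (maximalIdeal A) →ₗ[A] QuotSMulTop x (maximalIdeal A) :=
    Submodule.liftQ (x • ⊤ : Submodule A (maximalIdeal A)) φ (by
      intro y' hy
      obtain ⟨y, -, rfl⟩ := (Submodule.mem_smul_pointwise_iff_exists y' x _).1 hy
      rw [LinearMap.mem_ker, φ.map_smul]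
      obtain ⟨z, hz⟩ := Submodule.mkQ_surjective _ (φ y)
      rw [← hz, ← (Submodule.mkQ _).map_smul]
      exact (Submodule.Quotient.mk_eq_zero _).2
        ((Submodule.mem_smul_pointwise_iff_exists _ _ _).2 ⟨z, trivial, rfl⟩))
  have hψ : ∀ w, ψ w ∈ Submodule.span (A ⧸ Ideal.span {x}) {q x'} := fun w => by
    obtain ⟨w, rfl⟩ := Submodule.mkQ_surjective _ w
    change g (f _) ∈ _
    obtain ⟨a, ha⟩ := Submodule.mkQ_surjective _ (f ((maximalIdeal A).toCotangent w))
    rw [← ha]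
    exact Submodule.mem_span_singleton.2 ⟨Ideal.Quotient.mk _ a, rfl⟩
  let ψ' := ψ.extendScalarsOfSurjective (Ideal.Quotient.mk_surjective (I := Ideal.span {x}))
  refine ⟨q x', ψ'.codRestrict _ hψ, fun h => hx2 ?_, hmv, ?_⟩
  · obtain ⟨y, -, hy⟩ := (Submodule.mem_smul_pointwise_iff_exists _ _ _).1
      ((Submodule.Quotient.mk_eq_zero _).1 h)
    rw [show x = x * (y : A) from (congrArg Subtype.val hy).symm, pow_two]
    exact Ideal.mul_mem_mul hx y.2
  · rintro ⟨w, hw⟩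
    obtain ⟨b, rfl⟩ := Submodule.mem_span_singleton.1 hw
    refine Subtype.ext ?_
    change ψ' (b • q x') = b • q x'
    rw [map_smul]
    congr 1

/-- `K` is a copy of the residue field. Finite projective dimension passes to `𝔪`, then to `𝔪 / x𝔪`
over `A ⧸ (x)`, then to its retract, the residue field of a ring of smaller dimension. -/
theorem isRegularLocalRing_of_hasProjectiveDimensionLE (d : ℕ) {A : Type u} [CommRing A]
    [IsLocalRing A] [IsNoetherianRing A] (hd : ringKrullDim A ≤ d) (K : ModuleCat.{u} A)
    [Module.Finite A K] (v : K) (hv : v ≠ 0) (hspan : Submodule.span A {v} = ⊤)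
    (hmv : ∀ m ∈ maximalIdeal A, m • v = 0) (n : ℕ) (h : HasProjectiveDimensionLE K n) :
    IsRegularLocalRing A := by
  induction d using Nat.strong_induction_on generalizing A n with | _ d ih => ?_
  by_cases hbot : maximalIdeal A = ⊥
  · apply IsRegularLocalRing.of_spanFinrank_maximalIdeal_le
    rw [hbot, Submodule.spanFinrank_bot]
    exact_mod_cast ringKrullDim_nonneg_of_nontrivial
  have hmK : ∀ m ∈ maximalIdeal A, ∀ w : K, m • w = 0 := fun m hm w => by
    obtain ⟨a, rfl⟩ := Submodule.mem_span_singleton.1 (hspan ▸ Submodule.mem_top : w ∈ _)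
    rw [smul_comm, hmv m hm, smul_zero]
  obtain ⟨x, hx, hx2, hxreg⟩ := exists_regular_notMem_sq hbot fun a ha => by
    by_contra ha0
    exact hbot (maximalIdeal_eq_bot_of_socle ha0 ha n K v hv hmK h)
  have hxA : IsSMulRegular A x := .of_right_eq_zero_of_smul fun a ha =>
    (mem_nonZeroDivisors_iff.1 hxreg).1 a ha
  have hf : Function.Surjective (LinearMap.toSpanSingleton A K v) := by
    rw [← LinearMap.range_eq_top, LinearMap.range_toSpanSingleton, hspan]
  have hker : LinearMap.ker (LinearMap.toSpanSingleton A K v) = maximalIdeal A := by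
    refine le_antisymm (IsLocalRing.le_maximalIdeal fun htop => hv ?_) fun m hm => hmv m hm
    simpa using (htop ▸ Submodule.mem_top : (1 : A) ∈ LinearMap.ker (LinearMap.toSpanSingleton A K v))
  have h𝔪 : HasProjectiveDimensionLE (ModuleCat.of A (maximalIdeal A)) n := by
    rw [← hker]
    have hA : Projective (ModuleCat.of A A) := inferInstance
    -- The bound on `K` is first weakened by one, which avoids a separate case `n = 0`.
    exact ((LinearMap.shortExact_shortComplexKer hf).hasProjectiveDimensionLT_X₃_iff n hA).1
      (hasProjectiveDimensionLT_of_ge K (n + 1) (n + 2) (by lia))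
  have : Nontrivial (A ⧸ Ideal.span {x}) := Ideal.Quotient.nontrivial_iff.2 fun htop => by
    have := Ideal.span_singleton_eq_top.1 htop
    exact hx this
  have : IsLocalRing (A ⧸ Ideal.span {x}) :=
    .of_surjective' (Ideal.Quotient.mk _) Ideal.Quotient.mk_surjective
  have hB := hasProjectiveDimensionLE_quotSMulTop x hxA n (ModuleCat.of A (maximalIdeal A))
    (fun y z hyz => Subtype.ext (hxA (congrArg Subtype.val hyz))) h𝔪
  obtain ⟨w, r, hw, hmw, hr⟩ := exists_retract_quotSMulTop_maximalIdeal hx hx2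
  let ρ : Retract (ModuleCat.of (A ⧸ Ideal.span {x}) (Submodule.span (A ⧸ Ideal.span {x}) {w}))
      (ModuleCat.of (A ⧸ Ideal.span {x}) (QuotSMulTop x (maximalIdeal A))) :=
    { i := ModuleCat.ofHom (Submodule.subtype _)
      r := ModuleCat.ofHom r
      retract := ModuleCat.hom_ext (LinearMap.ext hr) }
  have hdim := ringKrullDim_quotient_succ_le_of_nonZeroDivisor hxreg
  refine isRegularLocalRing_of_quotient hx hxreg ?_
  cases d with
  | zero =>
    have h0 : (0 : WithBot ℕ∞) ≤ ringKrullDim (A ⧸ Ideal.span {x}) :=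
      ringKrullDim_nonneg_of_nontrivial
    have := (add_le_add_left h0 1).trans (hdim.trans hd)
    rw [zero_add] at this
    exact absurd this (not_le_of_gt (by exact_mod_cast zero_lt_one))
  | succ d =>
    refine ih d d.lt_succ_self ?_ (ModuleCat.of _ (Submodule.span (A ⧸ Ideal.span {x}) {w}))
      ⟨w, Submodule.mem_span_singleton_self w⟩ ?_ ?_ ?_ n
      (ρ.hasProjectiveDimensionLT _)
    · have := hdim.trans hd
      push_cast at this
      exact ENat.WithBot.add_le_add_one_right_iff.1 this
    · exact fun h => hw (congrArg Subtype.val h)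
    · rw [eq_top_iff]
      rintro ⟨y, hy⟩ -
      obtain ⟨b, rfl⟩ := Submodule.mem_span_singleton.1 hy
      exact Submodule.mem_span_singleton.2 ⟨b, rfl⟩
    · intro m hm
      obtain ⟨m, rfl⟩ := Ideal.Quotient.mk_surjective m
      have hloc : IsLocalHom (Ideal.Quotient.mk (Ideal.span {x})) :=
        .of_surjective _ Ideal.Quotient.mk_surjective
      refine Subtype.ext (hmw m ?_)
      rwa [← IsLocalRing.maximalIdeal_comap (Ideal.Quotient.mk (Ideal.span {x}))]

end Serre

/-! ### Consequences of non-regularity and of the Gorenstein property -/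

section Regular

variable {R : Type u} [CommRing R] [IsNoetherianRing R]

lemma isRegularLocalRing_localization_of_hasProjectiveDimensionLE (p : Ideal R) [p.IsPrime] (n : ℕ)
    (M : ModuleCat.{u} R) [Module.Finite R M] (v : M) (hspan : Submodule.span R {v} = ⊤)
    (hv : ∀ a : R, a • v = 0 ↔ a ∈ p) (h : HasProjectiveDimensionLE M n) :
    IsRegularLocalRing (Localization.AtPrime p) := by
  have hloc : HasProjectiveDimensionLE (M.localizedModule p.primeCompl) n :=
    M.localizedModule_hasProjectiveDimensionLE n p.primeCompl
  let ℓ := M.localizedModuleMkLinearMap p.primeCompl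
  have hℓ : IsLocalizedModule p.primeCompl ℓ :=
    ModuleCat.localizedModule_isLocalizedModule M p.primeCompl
  have : Module.Finite (Localization.AtPrime p) (M.localizedModule p.primeCompl) :=
    Module.Finite.of_isLocalizedModule p.primeCompl ℓ
  obtain ⟨d, hd⟩ : ∃ d : ℕ, ringKrullDim (Localization.AtPrime p) ≤ d := by
    obtain ⟨d, hd⟩ := WithBot.ne_bot_iff_exists.1
      (ringKrullDim_ne_bot (R := Localization.AtPrime p))
    have : d ≠ ⊤ := fun h => ringKrullDim_ne_top (R := Localization.AtPrime p) (by rw [← hd, h]; rfl)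
    obtain ⟨d, rfl⟩ := ENat.ne_top_iff_exists.1 this
    exact ⟨d, hd.ge⟩
  refine isRegularLocalRing_of_hasProjectiveDimensionLE d hd (M.localizedModule p.primeCompl)
    (ℓ v) ?_ ?_ ?_ n hloc
  · intro h0
    obtain ⟨s, hs⟩ := (IsLocalizedModule.eq_zero_iff p.primeCompl ℓ).1 h0
    exact s.2 ((hv s).1 hs)
  · rw [eq_top_iff]
    rintro y -
    obtain ⟨⟨z, s⟩, rfl⟩ := IsLocalizedModule.mk'_surjective p.primeCompl ℓ y
    obtain ⟨a, rfl⟩ := Submodule.mem_span_singleton.1 (hspan ▸ Submodule.mem_top : z ∈ _)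
    refine Submodule.mem_span_singleton.2
      ⟨IsLocalization.mk' (Localization.AtPrime p) a s, ?_⟩
    change _ = IsLocalizedModule.mk' ℓ (a • v) s
    rw [← IsLocalizedModule.mk'_one p.primeCompl ℓ v, IsLocalizedModule.mk'_smul_mk', mul_one]
  · rw [← IsLocalization.AtPrime.map_eq_maximalIdeal p (Localization.AtPrime p)]
    suffices h : Ideal.map (algebraMap R (Localization.AtPrime p)) p ≤
        LinearMap.ker (LinearMap.toSpanSingleton (Localization.AtPrime p) _ (ℓ v)) from
      fun m hm => h hm
    rw [Ideal.map_le_iff_le_comap]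
    intro a ha
    change algebraMap R (Localization.AtPrime p) a • ℓ v = 0
    rw [algebraMap_smul, ← map_smul, (hv a).2 ha, map_zero]

lemma exists_not_hasProjectiveDimensionLE (hR : ¬ IsRegularRing R) :
    ∃ M : ModuleCat.{u} R, Module.Finite R M ∧ ∀ n, ¬ HasProjectiveDimensionLE M n := by
  rw [isRegularRing_iff] at hR
  push Not at hR
  obtain ⟨p, hp, hpr⟩ := hR
  refine ⟨ModuleCat.of R (R ⧸ p), inferInstanceAs (Module.Finite R (R ⧸ p)), fun n h => hpr ?_⟩
  have : Module.Finite R (ModuleCat.of R (R ⧸ p)) := inferInstanceAs (Module.Finite R (R ⧸ p))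
  refine isRegularLocalRing_localization_of_hasProjectiveDimensionLE p n (ModuleCat.of R (R ⧸ p))
    (Ideal.Quotient.mk p 1) ?_ (fun a => ?_) h
  · rw [eq_top_iff]
    rintro y -
    obtain ⟨a, rfl⟩ := Ideal.Quotient.mk_surjective y
    exact Submodule.mem_span_singleton.2 ⟨a, congrArg (Ideal.Quotient.mk p) (mul_one a)⟩
  · rw [← Ideal.Quotient.eq_zero_iff_mem]
    exact iff_of_eq (congrArg (· = 0) (congrArg (Ideal.Quotient.mk p) (mul_one a)))

lemma LocallyExtTorsion.of_isGorensteinRing (hR : IsGorensteinRing R) :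
    LocallyExtTorsion (ModuleCat.of R R) := by
  intro p hp
  obtain ⟨n, hn⟩ := (injectiveDimension_ne_top_iff _).1 (hR.injectiveDimension_localization_ne_top p)
  exact ⟨n + 1, fun N _ i hi => extTorsion_primeCompl p (n + 1) hn N i hi⟩

end Regular

/-! ### Non-projective syzygies with vanishing Ext -/

section Syzygies

variable {R : Type u} [CommRing R] [IsNoetherianRing R]

lemma exists_syzygies (M : ModuleCat.{u} R) [Module.Finite R M] :
    ∃ S : ℕ → ModuleCat.{u} R, S 0 = M ∧ (∀ i, Module.Finite R (S i)) ∧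
      ∀ i, Nonempty (FreeExtension (S (i + 1)) (S i)) := by
  have h : ∀ B : {B : ModuleCat.{u} R // Module.Finite R B},
      ∃ A : {B : ModuleCat.{u} R // Module.Finite R B}, Nonempty (FreeExtension A.1 B.1) := by
    rintro ⟨B, hB⟩
    obtain ⟨A, ⟨E⟩⟩ := exists_freeExtension_left B
    exact ⟨⟨A, E.finite_left⟩, ⟨E⟩⟩
  choose f hf using h
  exact ⟨fun i => (f^[i] ⟨M, inferInstance⟩).1, rfl, fun i => (f^[i] ⟨M, inferInstance⟩).2,
    fun i => by
      simp only [Function.iterate_succ_apply']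
      exact hf _⟩

/-- If `Ext^i(M, R)` vanishes from degree `K` on, the syzygies from the `K`-th on have no positive
Ext into `R`; they all keep infinite projective dimension. -/
theorem exists_nonprojective_vanishingExt_syzygies (hR : IsGorensteinRing R)
    (hreg : ¬ IsRegularRing R) :
    ∃ S : ℕ → ModuleCat.{u} R, (∀ i, Nonempty (FreeExtension (S (i + 1)) (S i))) ∧
      (∀ i, VanishingExt (S i)) ∧ ∀ i, ¬ Projective (S i) := by
  obtain ⟨M, hM, hpd⟩ := exists_not_hasProjectiveDimensionLE hreg
  obtain ⟨S, rfl, hS, E⟩ := exists_syzygies M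
  obtain ⟨K, hK⟩ := (LocallyExtTorsion.of_isGorensteinRing hR).extEventuallyZero (S 0)
  have hvan : ∀ i j : ℕ, K ≤ i + (j + 1) → Subsingleton (Ext (S i) (ModuleCat.of R R) (j + 1)) := by
    intro i
    induction i with
    | zero => intro j hj; exact hK (j + 1) (by lia)
    | succ i ih =>
      intro j hj
      obtain ⟨E⟩ := E i
      have := E.projective
      exact (ExtTorsion.left E.shortExact (ExtTorsion.of_projective (N := E.F))
        (ExtTorsion.of_subsingleton (ih (j + 1) (by lia)))).subsingleton
  have hinf : ∀ i n : ℕ, ¬ HasProjectiveDimensionLE (S i) n := by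
    intro i
    induction i with
    | zero => exact hpd
    | succ i ih =>
      intro n hn
      obtain ⟨E⟩ := E i
      exact ih (n + 1) ((E.shortExact.hasProjectiveDimensionLT_X₃_iff n E.projective).2 hn)
  refine ⟨fun i => S (K + i), fun i => E (K + i), fun i => ⟨hS _, fun j => hvan _ _ (by lia)⟩,
    fun i h => hinf (K + i) 0 ((projective_iff_hasProjectiveDimensionLE_zero _).1 h)⟩

end Syzygies

/-! ### The free resolution spliced from the syzygies -/

section FreeResolution

variable {R : Type u} [CommRing R] (S : ℕ → ModuleCat.{u} R)
  (E : ∀ i, FreeExtension (S (i + 1)) (S i))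

/-- The chain complex of free modules obtained by splicing free extensions. -/
noncomputable def freeComplex : ChainComplex (ModuleCat.{u} R) ℕ :=
  ChainComplex.of (fun i => (E i).F) (fun i => (E (i + 1)).π ≫ (E i).ι)
    (fun i => by simp [reassoc_of% (E (i + 1)).zero])

lemma freeComplex_d (i : ℕ) :
    (freeComplex S E).d (i + 1) i = (E (i + 1)).π ≫ (E i).ι :=
  ChainComplex.of_d (fun i => (E i).F) (fun i => (E (i + 1)).π ≫ (E i).ι) i

lemma exact_comp_epi {C : Type*} [Category* C] [Abelian C] {X Y Z W : C} {f : X ⟶ Y} {g : Y ⟶ Z}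
    {p : W ⟶ X} [Epi p] {w : f ≫ g = 0} {w' : (p ≫ f) ≫ g = 0}
    (h : (ShortComplex.mk f g w).Exact) : (ShortComplex.mk (p ≫ f) g w').Exact := by
  let φ : ShortComplex.mk (p ≫ f) g w' ⟶ ShortComplex.mk f g w :=
    { τ₁ := p, τ₂ := 𝟙 _, τ₃ := 𝟙 _ }
  exact (ShortComplex.exact_iff_of_epi_of_isIso_of_mono φ).2 h

lemma exact_comp_mono {C : Type*} [Category* C] [Abelian C] {X Y Z W : C} {f : X ⟶ Y} {g : Y ⟶ Z}
    {p : Z ⟶ W} [Mono p] {w : f ≫ g = 0} {w' : f ≫ (g ≫ p) = 0}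
    (h : (ShortComplex.mk f g w).Exact) : (ShortComplex.mk f (g ≫ p) w').Exact := by
  let φ : ShortComplex.mk f g w ⟶ ShortComplex.mk f (g ≫ p) w' :=
    { τ₁ := 𝟙 _, τ₂ := 𝟙 _, τ₃ := p }
  exact (ShortComplex.exact_iff_of_epi_of_isIso_of_mono φ).1 h

/-- The free resolution obtained by splicing free extensions. -/
noncomputable def freeResolution : ProjectiveResolution (S 0) where
  complex := freeComplex S E
  projective i := (E i).projective
  π := (ChainComplex.toSingle₀Equiv _ _).symm ⟨(E 0).π, by
    rw [freeComplex_d]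
    exact (Category.assoc _ _ _).trans ((congrArg _ (E 0).zero).trans comp_zero)⟩
  quasiIso := ⟨fun n => by
    have h (i) : Mono (E i).ι := (E i).shortExact.mono_f
    have h' (i) : Epi (E i).π := (E i).shortExact.epi_g
    cases n
    · rw [ChainComplex.quasiIsoAt₀_iff, ShortComplex.quasiIso_iff_of_zeros']
      · dsimp
        refine (ShortComplex.exact_and_epi_g_iff_of_iso ?_).2
          ⟨exact_comp_epi (p := (E 1).π) (w' := by simp [(E 0).zero]) (E 0).shortExact.exact, h' 0⟩
        exact ShortComplex.isoMk (Iso.refl _) (Iso.refl _) (Iso.refl _)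
          ((Category.id_comp _).trans ((freeComplex_d S E 0).symm.trans (Category.comp_id _).symm))
          (by
            refine (Category.id_comp _).trans (Eq.trans ?_ (Category.comp_id _).symm)
            exact (ChainComplex.toSingle₀Equiv_symm_apply_f_zero (C := freeComplex S E) (E 0).π _).symm)
      all_goals rfl
    · rw [quasiIsoAt_iff_exactAt']
      · rename_i n
        rw [HomologicalComplex.exactAt_iff' _ (n + 1 + 1) (n + 1) n (by simp) (by simp)]
        refine (ShortComplex.exact_iff_of_iso ?_).2 (exact_comp_mono (p := (E n).ι)
          (w' := by simp [reassoc_of% (E (n + 1)).zero])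
          (exact_comp_epi (p := (E (n + 2)).π) (w' := by simp [(E (n + 1)).zero])
            (E (n + 1)).shortExact.exact))
        exact ShortComplex.isoMk (Iso.refl _) (Iso.refl _) (Iso.refl _)
          ((Category.id_comp _).trans
            ((freeComplex_d S E (n + 1)).symm.trans (Category.comp_id _).symm))
          ((Category.id_comp _).trans ((freeComplex_d S E n).symm.trans (Category.comp_id _).symm))
      · apply ChainComplex.exactAt_succ_single_obj⟩

end FreeResolution

/-! ### Terms and homology of the truncated resolution -/

section Truncated

variable {R : Type u} [CommRing R] {G : ModuleCat.{u} R} (F : ProjectiveResolution G) (n : ℕ)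

instance : (truncatedResolution F n).IsStrictlyGE (-(n : ℤ)) := by
  dsimp [truncatedResolution]
  infer_instance

instance : (truncatedResolution F n).IsStrictlyLE 0 := by
  dsimp [truncatedResolution]
  infer_instance

lemma conj_trans_iso {C : Type*} [Category* C] {X Y Z W X' Y' Z' W' : C} (a : X ≅ Y) (b : Y ≅ Z)
    (c : Z ≅ W) (d : W ⟶ W') (a' : X' ≅ Y') (b' : Y' ≅ Z') (c' : Z' ≅ W') :
    ((a ≪≫ b ≪≫ c).hom ≫ d) ≫ (a' ≪≫ b' ≪≫ c').inv =
      a.hom ≫ (b.hom ≫ (c.hom ≫ d ≫ c'.inv) ≫ b'.inv) ≫ a'.inv := by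
  simp

/-- The terms of the truncated resolution. -/
noncomputable def truncatedResolutionXIso (i : ℕ) (hi : i ≤ n) (j : ℤ) (hj : -(i : ℤ) = j) :
    (truncatedResolution F n).X j ≅ F.complex.X i :=
  (F.cochainComplex.restriction (ComplexShape.embeddingUpIntGE (-(n : ℤ)))).extendXIso
    -- The embedding sends `k` to `-n + k`, so degree `-i` has index `n - i`.
    (ComplexShape.embeddingUpIntGE (-(n : ℤ))) (i := n - i) (by simp; lia) ≪≫
  F.cochainComplex.restrictionXIso (ComplexShape.embeddingUpIntGE (-(n : ℤ))) (by simp; lia) ≪≫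
  F.cochainComplexXIso j i hj

lemma truncatedResolutionXIso_hom_comp_d (i i' : ℕ) (hi : i ≤ n) (hi' : i' ≤ n) (j j' : ℤ)
    (hj : -(i : ℤ) = j) (hj' : -(i' : ℤ) = j') :
    (truncatedResolutionXIso F n i hi j hj).hom ≫ F.complex.d i i' =
      (truncatedResolution F n).d j j' ≫ (truncatedResolutionXIso F n i' hi' j' hj').hom := by
  have h1 : (ComplexShape.embeddingUpIntGE (-(n : ℤ))).f (n - i) = j := by simp; lia
  have h2 : (ComplexShape.embeddingUpIntGE (-(n : ℤ))).f (n - i') = j' := by simp; lia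
  have h3 : (truncatedResolution F n).d j j' = _ := HomologicalComplex.extend_d_eq
    (F.cochainComplex.restriction (ComplexShape.embeddingUpIntGE (-(n : ℤ))))
    (ComplexShape.embeddingUpIntGE (-(n : ℤ))) h1 h2
  have h4 := HomologicalComplex.restriction_d_eq F.cochainComplex
    (ComplexShape.embeddingUpIntGE (-(n : ℤ))) h1 h2
  have h5 := F.cochainComplex_d j j' i i' hj hj'
  rw [h4, h5] at h3
  rw [← Iso.comp_inv_eq, h3]
  exact conj_trans_iso _ _ _ _ _ _ _

lemma truncatedResolution_exactAt (i : ℕ) (hi : i + 2 ≤ n) (j : ℤ) (hj : -((i + 1 : ℕ) : ℤ) = j) :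
    (truncatedResolution F n).ExactAt j := by
  rw [HomologicalComplex.exactAt_iff' _ (-((i + 2 : ℕ) : ℤ)) j (-(i : ℤ))
    (by simp; lia) (by simp; lia)]
  refine (ShortComplex.exact_iff_of_iso ?_).2 (F.exact_succ i)
  exact ShortComplex.isoMk (truncatedResolutionXIso F n (i + 2) hi _ rfl)
    (truncatedResolutionXIso F n (i + 1) (by lia) _ hj)
    (truncatedResolutionXIso F n i (by lia) _ rfl)
    (truncatedResolutionXIso_hom_comp_d F n _ _ _ _ _ _ _ _)
    (truncatedResolutionXIso_hom_comp_d F n _ _ _ _ _ _ _ _)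

lemma nonempty_truncatedResolution_homology_zero_iso (hn : 1 ≤ n) :
    Nonempty ((truncatedResolution F n).homology 0 ≅ G) := by
  let K := truncatedResolution F n
  have h0 : K.d 0 1 = 0 := (CochainComplex.isZero_of_isStrictlyLE K 0 1).eq_of_tgt _ _
  let e₁ : K.homology 0 ≅ K.opcycles 0 :=
    K.isoHomologyι 0 1 (by simp) h0
  let e₂ := (K.opcyclesIsCokernel (-((1 : ℕ) : ℤ)) 0 (by simp)).coconePointUniqueUpToIso
    (cokernelIsCokernel _)
  let e₃ : cokernel (K.d (-((1 : ℕ) : ℤ)) 0) ≅ cokernel (F.complex.d 1 0) :=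
    cokernel.mapIso _ _ (truncatedResolutionXIso F n 1 hn _ rfl)
      (truncatedResolutionXIso F n 0 (by lia) _ rfl)
      (truncatedResolutionXIso_hom_comp_d F n _ _ _ _ _ _ _ _).symm
  let e₄ := (cokernelIsCokernel (F.complex.d 1 0)).coconePointUniqueUpToIso
    F.isColimitCokernelCofork
  exact ⟨e₁ ≪≫ e₂ ≪≫ e₃ ≪≫ e₄⟩

lemma nonempty_truncatedResolution_homology_neg_iso (i : ℕ) (hi : i + 1 = n) :
    Nonempty ((truncatedResolution F n).homology (-(n : ℤ)) ≅ kernel (F.complex.d n i)) := by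
  let K := truncatedResolution F n
  have h0 : K.d (-(n : ℤ) - 1) (-(n : ℤ)) = 0 :=
    (CochainComplex.isZero_of_isStrictlyGE K (-(n : ℤ)) _).eq_of_src _ _
  let e₁ : K.homology (-(n : ℤ)) ≅ K.cycles (-(n : ℤ)) :=
    (K.isoHomologyπ (-(n : ℤ) - 1) (-(n : ℤ)) (by simp) h0).symm
  let e₂ := (K.cyclesIsKernel (-(n : ℤ)) (-(i : ℤ)) (by simp; lia)).conePointUniqueUpToIso
    (kernelIsKernel _)
  let e₃ : kernel (K.d (-(n : ℤ)) (-(i : ℤ))) ≅ kernel (F.complex.d n i) :=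
    kernel.mapIso _ _ (truncatedResolutionXIso F n n le_rfl _ rfl)
      (truncatedResolutionXIso F n i (by lia) _ rfl)
      (truncatedResolutionXIso_hom_comp_d F n _ _ _ _ _ _ _ _).symm
  exact ⟨e₁ ≪≫ e₂ ≪≫ e₃⟩

end Truncated

/-! ### The triangle of a complex with homology in two degrees -/

section TwoStep

lemma distinguished_of_iso {T : Type*} [Category* T] [HasZeroObject T] [HasShift T ℤ]
    [Preadditive T] [∀ n : ℤ, (shiftFunctor T n).Additive] [Pretriangulated T]
    {X Y Z X' Z' : T} {f : X ⟶ Y} {g : Y ⟶ Z} {h : Z ⟶ X⟦(1 : ℤ)⟧}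
    (hT : Pretriangulated.Triangle.mk f g h ∈ Pretriangulated.distinguishedTriangles)
    (e : X ≅ X') (e' : Z ≅ Z') :
    Pretriangulated.Triangle.mk (e.inv ≫ f) (g ≫ e'.hom) (e'.inv ≫ h ≫ e.hom⟦(1 : ℤ)⟧') ∈
      Pretriangulated.distinguishedTriangles :=
  Pretriangulated.isomorphic_distinguished _ hT _
    (Pretriangulated.Triangle.isoMk _ _ e.symm (Iso.refl _) e'.symm
      (Category.comp_id _)
      ((Category.assoc _ _ _).trans ((congrArg _ e'.hom_inv_id).trans
        ((Category.comp_id _).trans (Category.id_comp _).symm)))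
      (by
        change (e'.inv ≫ h ≫ e.hom⟦(1 : ℤ)⟧') ≫ e.inv⟦(1 : ℤ)⟧' = e'.inv ≫ h
        rw [Category.assoc, Category.assoc, ← Functor.map_comp, e.hom_inv_id,
          CategoryTheory.Functor.map_id,
          Category.comp_id]))

variable {R : Type u} [CommRing R] [HasDerivedCategory.{w} (ModuleCat.{u} R)]

open DerivedCategory Pretriangulated

lemma exists_iso_singleFunctor_of_homology (K : CochainComplex (ModuleCat.{u} R) ℤ) (i : ℤ)
    (hGE : (Q.obj K).IsGE i) (hLE : (Q.obj K).IsLE i) :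
    Nonempty (Q.obj K ≅ (singleFunctor (ModuleCat.{u} R) i).obj (K.homology i)) := by
  obtain ⟨Y, ⟨e⟩⟩ := exists_iso_singleFunctor_obj_of_isGE_of_isLE (Q.obj K) i
  let e' : K.homology i ≅ Y :=
    ((homologyFunctorFactors (ModuleCat.{u} R) i).app K).symm ≪≫
      (homologyFunctor (ModuleCat.{u} R) i).mapIso e ≪≫
      (singleFunctorCompHomologyFunctorIso (ModuleCat.{u} R) i).app Y
  exact ⟨e ≪≫ (singleFunctor (ModuleCat.{u} R) i).mapIso e'.symm⟩

/-- This is the canonical truncation triangle at degree `-1`: each truncation has homology in one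
degree only, hence is a shifted module. -/
lemma exists_distinguished_of_exactAt (K : CochainComplex (ModuleCat.{u} R) ℤ) (n : ℕ) (hn : 1 ≤ n)
    [K.IsStrictlyGE (-(n : ℤ))] [K.IsStrictlyLE 0]
    (hK : ∀ i : ℤ, -(n : ℤ) < i → i < 0 → K.ExactAt i) :
    ∃ (f : ((singleFunctor (ModuleCat.{u} R) 0).obj (K.homology (-(n : ℤ))))⟦(n : ℤ)⟧ ⟶ Q.obj K)
      (g : Q.obj K ⟶ (singleFunctor (ModuleCat.{u} R) 0).obj (K.homology 0))
      (h : (singleFunctor (ModuleCat.{u} R) 0).obj (K.homology 0) ⟶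
        (((singleFunctor (ModuleCat.{u} R) 0).obj (K.homology (-(n : ℤ))))⟦(n : ℤ)⟧)⟦(1 : ℤ)⟧),
      Triangle.mk f g h ∈ distTriang _ := by
  have hs := K.shortComplexTruncLE_shortExact (-1)
  let A := K.truncLE (-1)
  let B := K.truncGE 0
  have hA : Nonempty (Q.obj A ≅
      (singleFunctor (ModuleCat.{u} R) (-(n : ℤ))).obj (K.homology (-(n : ℤ)))) := by
    have hGE : (Q.obj A).IsGE (-(n : ℤ)) := by
      rw [isGE_Q_obj_iff]
      infer_instance
    have hLE : (Q.obj A).IsLE (-(n : ℤ)) := by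
      rw [isLE_Q_obj_iff, CochainComplex.isLE_iff]
      intro i hi
      by_cases h : i ≤ -1
      · have := K.quasiIsoAt_ιTruncLE (-1) i h
        exact (quasiIsoAt_iff_exactAt' (K.ιTruncLE (-1)) i (hK i hi (by lia))).1 this
      · exact CochainComplex.exactAt_of_isLE A (-1) i
    have := K.quasiIsoAt_ιTruncLE (-1) (-(n : ℤ)) (by lia)
    obtain ⟨e⟩ := exists_iso_singleFunctor_of_homology A _ hGE hLE
    exact ⟨e ≪≫ (singleFunctor _ _).mapIso (isoOfQuasiIsoAt (K.ιTruncLE (-1)) (-(n : ℤ)))⟩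
  have hB : Nonempty (Q.obj B ≅
      (singleFunctor (ModuleCat.{u} R) 0).obj (K.homology 0)) := by
    have hGE : (Q.obj B).IsGE 0 := by
      rw [isGE_Q_obj_iff]
      infer_instance
    have hLE : (Q.obj B).IsLE 0 := by
      rw [isLE_Q_obj_iff]
      infer_instance
    obtain ⟨e⟩ := exists_iso_singleFunctor_of_homology B _ hGE hLE
    exact ⟨e ≪≫ (singleFunctor _ _).mapIso (isoOfQuasiIsoAt (K.πTruncGE 0) 0).symm⟩
  obtain ⟨eA⟩ := hA
  obtain ⟨eB⟩ := hB
  let eA' := eA ≪≫ (((singleFunctors (ModuleCat.{u} R)).shiftIso (n : ℤ) (-(n : ℤ)) 0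
    (by lia)).app (K.homology (-(n : ℤ)))).symm
  let eB' := (asIso (Q.map (K.shortComplexTruncLEX₃ToTruncGE (-1) 0 (by lia)))) ≪≫ eB
  exact ⟨_, _, _, distinguished_of_iso (triangleOfSES_distinguished hs) eA' eB'⟩

end TwoStep

/-! ### The ghost lemma and bounds on levels -/

section Ghost

open Pretriangulated ObjectProperty

variable {T : Type*} [Category* T] [HasZeroObject T] [HasShift T ℤ] [Preadditive T]
  [∀ n : ℤ, (shiftFunctor T n).Additive] [Pretriangulated T]

/-- A morphism is ghost with respect to a collection of objects if it vanishes after precomposition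
with morphisms from shifts of objects in the collection. -/
def IsGhost (C : ObjectProperty T) {X Y : T} (f : X ⟶ Y) : Prop :=
  ∀ (W : T) (_ : C W) (j : ℤ) (φ : W⟦j⟧ ⟶ X), φ ≫ f = 0

lemma IsGhost.comp_eq_zero {C : ObjectProperty T} {X Y : T} {f : X ⟶ Y} (hf : IsGhost C f) {W : T}
    (hW : (C.shiftClosure ℤ).binaryProductsClosure.retractClosure W) (φ : W ⟶ X) : φ ≫ f = 0 := by
  obtain ⟨W', hW', ⟨r⟩⟩ := hW
  suffices h : ∀ φ : W' ⟶ X, φ ≫ f = 0 by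
    rw [← Category.id_comp (φ ≫ f), ← r.retract, Category.assoc, ← Category.assoc r.r, h, comp_zero]
  let P : ObjectProperty T := fun W => ∀ φ : W ⟶ X, φ ≫ f = 0
  have hP : (C.shiftClosure ℤ).binaryProductsClosure ≤ P := by
    have : P.IsClosedUnderIsomorphisms := ⟨fun e h φ => by
      rw [← cancel_epi e.hom, ← Category.assoc, h, comp_zero]⟩
    have : P.IsClosedUnderBinaryProducts := by
      refine ⟨?_⟩
      rintro W ⟨p⟩
      let e : W ≅ p.diag.obj (.mk .left) ⊞ p.diag.obj (.mk .right) :=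
        IsLimit.conePointUniqueUpToIso
          ((IsLimit.postcomposeHomEquiv (diagramIsoPair p.diag) _).2 p.isLimit) (prodIsProd _ _) ≪≫
        (biprod.isoProd _ _).symm
      refine P.prop_of_iso e.symm fun φ => ?_
      ext
      · simpa using p.prop_diag_obj (.mk .left) (biprod.inl ≫ φ)
      · simpa using p.prop_diag_obj (.mk .right) (biprod.inr ≫ φ)
    have : P.ContainsZero := ⟨_, isZero_zero T, fun φ => (isZero_zero T).eq_of_src _ _⟩
    rw [binaryProductsClosure_le_iff]
    rintro W ⟨A, j, e, hA⟩ φ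
    rw [← cancel_epi e.inv, ← Category.assoc, hf A hA j (e.inv ≫ φ), comp_zero]
  exact hP W' hW'

/-- The ghost lemma, for a compatible family of maps into a chain of ghosts. The first `m + 1`
ghosts kill `K`, so the map factors through `N`, a one-step object killed by the next ghost. -/
lemma eq_zero_of_triangEnvelopeIter [IsTriangulated T] {C : ObjectProperty T} {X : ℕ → T}
    (δ : ∀ i, X i ⟶ X (i + 1)) (hδ : ∀ i, IsGhost C (δ i)) (m : ℕ) {W : T}
    (hW : C.triangEnvelopeIter m W) (c : ∀ i, W ⟶ X i) (hc : ∀ i, c i ≫ δ i = c (i + 1)) :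
    c (m + 1) = 0 := by
  induction m generalizing W with
  | zero =>
    rw [triangEnvelopeIter_zero] at hW
    rw [← hc, (hδ 0).comp_eq_zero hW]
  | succ m ih =>
    -- In this form the one-step object is the third vertex and the inductive hypothesis applies to
    -- the first.
    rw [triangEnvelopeIter_succ'] at hW
    obtain ⟨W', ⟨K, N, f, g, h, hT, hK, hN⟩, ⟨r⟩⟩ := hW
    have h0 : f ≫ r.r ≫ c (m + 1) = 0 :=
      ih hK (fun i => f ≫ r.r ≫ c i) (fun i => by simp [hc])
    obtain ⟨φ, hφ⟩ := Triangle.yoneda_exact₂ _ hT _ h0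
    have h1 : r.r ≫ c (m + 1 + 1) = 0 := by
      rw [← hc, ← Category.assoc, hφ]
      exact (Category.assoc _ _ _).trans
        ((congrArg _ ((hδ (m + 1)).comp_eq_zero hN φ)).trans comp_zero)
    rw [← Category.id_comp (c _), ← r.retract, Category.assoc, h1, comp_zero]

lemma level_le_of_triangEnvelopeIter {C : ObjectProperty T} {M : T} {n : ℕ}
    (h : C.triangEnvelopeIter n M) : level C M ≤ ((n + 1 : ℕ) : ℕ∞) := by
  unfold level
  split_ifs
  · exact zero_le
  · exact iInf₂_le n h

lemma le_level_of_not_triangEnvelopeIter {C : ObjectProperty T} {M : T} (hM : ¬ IsZero M) {n : ℕ}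
    (h : ¬ C.triangEnvelopeIter n M) : ((n + 2 : ℕ) : ℕ∞) ≤ level C M := by
  unfold level
  rw [if_neg hM]
  refine le_iInf₂ fun m hm => ?_
  have : n < m := by
    by_contra! hmn
    exact h (C.monotone'_triangEnvelopeIter hmn M hm)
  exact_mod_cast Nat.succ_le_succ this

end Ghost

/-! ### Extension classes as ghost maps -/

section GhostExt

open DerivedCategory

variable {R : Type u} [CommRing R] [HasDerivedCategory.{w} (ModuleCat.{u} R)]

lemma eq_zero_of_projective_shift {A B : ModuleCat.{u} R} [Projective A] (j m : ℤ) (h : j < m)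
    (f : ((singleFunctor (ModuleCat.{u} R) 0).obj A)⟦j⟧ ⟶
      ((singleFunctor (ModuleCat.{u} R) 0).obj B)⟦m⟧) : f = 0 := by
  obtain ⟨d, hd⟩ : ∃ d : ℕ, ((d + 1 : ℕ) : ℤ) + j = m := ⟨(m - j - 1).toNat, by lia⟩
  let e := (shiftFunctorAdd' (DerivedCategory (ModuleCat.{u} R)) ((d + 1 : ℕ) : ℤ) j m hd).app
    ((singleFunctor (ModuleCat.{u} R) 0).obj B)
  rw [← cancel_mono e.hom, zero_comp]
  obtain ⟨g, hg⟩ := (shiftFunctor (DerivedCategory (ModuleCat.{u} R)) j).map_surjective (f ≫ e.hom)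
  have : g = 0 := by
    have h0 : (Ext.homEquiv (X := A) (Y := B) (n := d + 1)).symm g = 0 := Ext.eq_zero_of_projective _
    rw [Equiv.symm_apply_eq] at h0
    exact h0.trans (Ext.zero_hom _ _ _)
  rw [← hg, this, Functor.map_zero]

lemma eq_zero_of_shift_of_lt {A B : ModuleCat.{u} R} (j m : ℤ) (h : m < j)
    (f : ((singleFunctor (ModuleCat.{u} R) 0).obj A)⟦j⟧ ⟶
      ((singleFunctor (ModuleCat.{u} R) 0).obj B)⟦m⟧) : f = 0 := by
  have h1 := TStructure.t.isLE_shift ((singleFunctor (ModuleCat.{u} R) 0).obj A) 0 j (-j) (by lia)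
  have h2 := TStructure.t.isGE_shift ((singleFunctor (ModuleCat.{u} R) 0).obj B) 0 m (-m) (by lia)
  exact TStructure.t.zero_of_isLE_of_isGE f (-j) (-m) (by lia) h1 h2

/-- The morphism `B⟦i⟧ ⟶ A⟦i + 1⟧` in the derived category attached to an extension class. -/
noncomputable def extShiftHom {A B : ModuleCat.{u} R} (x : Ext B A 1) (i : ℕ) :
    ((singleFunctor (ModuleCat.{u} R) 0).obj B)⟦(i : ℤ)⟧ ⟶
      ((singleFunctor (ModuleCat.{u} R) 0).obj A)⟦((i + 1 : ℕ) : ℤ)⟧ :=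
  x.hom⟦(i : ℤ)⟧' ≫ (shiftFunctorAdd' (DerivedCategory (ModuleCat.{u} R)) ((1 : ℕ) : ℤ) (i : ℤ)
    ((i + 1 : ℕ) : ℤ) (by push_cast; ring)).inv.app _

lemma hom_comp_extShiftHom {A B G : ModuleCat.{u} R} (x : Ext B A 1) (i : ℕ) (y : Ext G B i) :
    y.hom ≫ extShiftHom x i = (y.comp x rfl).hom := by
  rw [Ext.comp_hom]
  rfl

/-- For `R⟦j⟧ ⟶ B⟦i⟧` with `j > i` the map has negative degree and vanishes; for `j ≤ i` the
composite is a positive Ext class of the projective `R`. -/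
lemma isGhost_extShiftHom {A B : ModuleCat.{u} R} (x : Ext B A 1) (i : ℕ) :
    IsGhost (ringCollection R) (extShiftHom x i) := by
  rintro _ ⟨⟩ j φ
  by_cases h : (i : ℤ) < j
  · rw [eq_zero_of_shift_of_lt _ _ h φ, zero_comp]
  · have : Projective (ModuleCat.of R R) := inferInstance
    exact eq_zero_of_projective_shift _ _ (by push_cast; lia) _

end GhostExt

/-! ### Non-vanishing of the Yoneda product -/

section YonedaProduct

variable {R : Type u} [CommRing R] {S : ℕ → ModuleCat.{u} R}
  (E : ∀ i, FreeExtension (S (i + 1)) (S i))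

/-- The Yoneda product of the first `n` extensions. -/
noncomputable def yonedaProduct : ∀ n : ℕ, Ext (S 0) (S n) n
  | 0 => Ext.mk₀ (𝟙 _)
  | n + 1 => (yonedaProduct n).comp (E n).shortExact.extClass rfl

lemma subsingleton_ext_of_free {G F : ModuleCat.{u} R} (hG : VanishingExt G) [Module.Free R F]
    [Module.Finite R F] (i : ℕ) : Subsingleton (Ext G F (i + 1)) := by
  refine subsingleton_of_forall_eq 0 fun y => ?_
  let b := Module.Free.chooseBasis R F
  have hid : 𝟙 F = ∑ j, ModuleCat.ofHom (b.coord j) ≫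
      ModuleCat.ofHom (LinearMap.toSpanSingleton R F (b j)) := by
    ext x
    simp [ModuleCat.hom_sum, b.sum_repr]
  have := hG.subsingleton i
  rw [← y.comp_mk₀_id, hid, Ext.mk₀_sum, Ext.comp_sum]
  refine Finset.sum_eq_zero fun j _ => ?_
  rw [← Ext.mk₀_comp_mk₀, ← Ext.comp_assoc_of_second_deg_zero,
    Subsingleton.elim (y.comp (Ext.mk₀ (ModuleCat.ofHom (b.coord j))) _) 0, Ext.zero_comp]

/-- If the next product vanishes, the current one lifts to `Ext^n(S 0, F_n)`. This group is zero for
`n > 0`, and for `n = 0` the lift splits `F_0 ⟶ S 0`, making `S 0` projective. -/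
lemma yonedaProduct_ne_zero (hS : VanishingExt (S 0)) (hS' : ¬ Projective (S 0)) (n : ℕ) :
    yonedaProduct E n ≠ 0 := by
  induction n with
  | zero =>
    intro h
    have h' : 𝟙 (S 0) = 0 := (Ext.mk₀_bijective _ _).1 (h.trans (Ext.mk₀_zero _ _).symm)
    exact hS' ((IsZero.iff_id_eq_zero _).2 h').projective
  | succ n ih =>
    intro h
    obtain ⟨y, hy⟩ := Ext.covariant_sequence_exact₃ (S 0) (E n).shortExact (yonedaProduct E n) rfl h
    obtain _ | n := n
    · obtain ⟨s, rfl⟩ := (Ext.mk₀_bijective _ _).2 y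
      have hs : s ≫ (E 0).π = 𝟙 _ := (Ext.mk₀_bijective _ _).1 ((Ext.mk₀_comp_mk₀ _ _).symm.trans hy)
      have := (E 0).projective
      exact hS' (Retract.projective ⟨s, (E 0).π, hs⟩)
    · have := (E (n + 1)).free
      have := (E (n + 1)).finite
      have := subsingleton_ext_of_free hS (F := (E (n + 1)).F) n
      refine ih (hy ▸ ?_)
      rw [Subsingleton.elim y 0, Ext.zero_comp]

end YonedaProduct

/-- The term of top degree is a subcomplex, and `L` is the quotient, a brutal truncation. -/
lemma exists_shortExact_single {R : Type u} [CommRing R]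
    (K : CochainComplex (ModuleCat.{u} R) ℤ) (a b : ℤ)
    [K.IsStrictlyGE a] [K.IsStrictlyLE (b + 1)] :
    ∃ (L : CochainComplex (ModuleCat.{u} R) ℤ)
      (f : (HomologicalComplex.single (ModuleCat.{u} R) (ComplexShape.up ℤ) (b + 1)).obj
        (K.X (b + 1)) ⟶ K) (g : K ⟶ L) (w : f ≫ g = 0),
      (ShortComplex.mk f g w).ShortExact ∧ L.IsStrictlyGE a ∧ L.IsStrictlyLE b ∧
      ∀ i, IsZero (L.X i) ∨ Nonempty (K.X i ≅ L.X i) := by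
  let f : (HomologicalComplex.single (ModuleCat.{u} R) (ComplexShape.up ℤ) (b + 1)).obj
      (K.X (b + 1)) ⟶ K := HomologicalComplex.mkHomFromSingle (𝟙 _) (fun j hj =>
        (CochainComplex.isZero_of_isStrictlyLE K (b + 1) j (by
          have : b + 1 + 1 = j := hj
          lia)).eq_of_tgt _ _)
  have hf0 : ∀ i, i ≠ b + 1 → IsZero (((HomologicalComplex.single (ModuleCat.{u} R)
      (ComplexShape.up ℤ) (b + 1)).obj (K.X (b + 1))).X i) := fun i hi =>
    HomologicalComplex.isZero_single_obj_X _ _ _ _ hi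
  have hfb : IsIso (f.f (b + 1)) := by
    simp only [f, HomologicalComplex.mkHomFromSingle_f]
    infer_instance
  have hf : Mono f := HomologicalComplex.mono_of_mono_f f fun i => by
    by_cases h : i = b + 1
    · subst h; infer_instance
    · exact ⟨fun _ _ _ => (hf0 i h).eq_of_tgt _ _⟩
  have hS : (ShortComplex.mk f (cokernel.π f) (cokernel.condition f)).ShortExact :=
    { exact := ShortComplex.exact_cokernel f }
  have hSi := (HomologicalComplex.shortExact_iff_degreewise_shortExact _).1 hS
  have hL : ∀ i, i ≠ b + 1 → Nonempty (K.X i ≅ (cokernel f).X i) := fun i hi => by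
    have : IsIso ((cokernel.π f).f i) := (hSi i).isIso_g_iff.2 (hf0 i hi)
    exact ⟨asIso ((cokernel.π f).f i)⟩
  have hL' : IsZero ((cokernel f).X (b + 1)) := (hSi (b + 1)).isIso_f_iff.1 hfb
  refine ⟨cokernel f, f, cokernel.π f, cokernel.condition f, hS, ?_, ?_, ?_⟩
  · rw [CochainComplex.isStrictlyGE_iff]
    intro i hi
    by_cases h : i = b + 1
    · subst h; exact hL'
    · obtain ⟨e⟩ := hL i h
      exact (CochainComplex.isZero_of_isStrictlyGE K a i (by lia)).of_iso e.symm
  · rw [CochainComplex.isStrictlyLE_iff]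
    intro i hi
    by_cases h : i = b + 1
    · subst h; exact hL'
    · obtain ⟨e⟩ := hL i h
      exact (CochainComplex.isZero_of_isStrictlyLE K (b + 1) i (by lia)).of_iso e.symm
  · intro i
    by_cases h : i = b + 1
    · subst h; exact Or.inl hL'
    · exact Or.inr (hL i h)

/-! ### Upper bound for the level by the number of terms -/

section Cells

open DerivedCategory Pretriangulated ObjectProperty

variable {R : Type u} [CommRing R] [HasDerivedCategory.{w} (ModuleCat.{u} R)]

lemma binaryProductsClosure_single (j : ℤ) (n : ℕ) (M : ModuleCat.{u} R)
    (e : M ≃ₗ[R] (Fin (n + 1) → R)) :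
    ((ringCollection R).shiftClosure ℤ).binaryProductsClosure
      ((singleFunctor (ModuleCat.{u} R) j).obj M) := by
  induction n generalizing M with
  | zero =>
    let e' : M ≅ ModuleCat.of R R := (e.trans (LinearEquiv.funUnique (Fin 1) R R)).toModuleIso
    refine limitsClosure.of_isoClosure ((singleFunctor (ModuleCat.{u} R) j).mapIso e'.symm)
      (limitsClosure.of_mem _ ⟨(singleFunctor (ModuleCat.{u} R) 0).obj (ModuleCat.of R R), -j,
        (((singleFunctors (ModuleCat.{u} R)).shiftIso (-j) j 0 (by lia)).app _).symm, ?_⟩)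
    exact (ObjectProperty.singleton_iff _ _).2 rfl
  | succ n ih =>
    have : PreservesBinaryBiproducts (singleFunctor (ModuleCat.{u} R) j) :=
      preservesBinaryBiproducts_of_preservesBiproducts _
    let N := ModuleCat.of R (Fin (n + 1) → R)
    let e' : M ≅ ModuleCat.of R R ⊞ N :=
      (e.trans (Fin.consLinearEquiv R (fun _ : Fin (n + 2) => R)).symm).toModuleIso ≪≫
        (ModuleCat.biprodIsoProd (ModuleCat.of R R) N).symm
    refine limitsClosure.of_isoClosure (((singleFunctor (ModuleCat.{u} R) j).mapIso e' ≪≫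
      (singleFunctor (ModuleCat.{u} R) j).mapBiprod _ _ ≪≫ biprod.isoProd _ _).symm) ?_
    refine prop_prod _ _ _ (limitsClosure.of_mem _
      ⟨(singleFunctor (ModuleCat.{u} R) 0).obj (ModuleCat.of R R), -j,
        (((singleFunctors (ModuleCat.{u} R)).shiftIso (-j) j 0 (by lia)).app _).symm, ?_⟩)
        (ih N (LinearEquiv.refl R _))
    exact (ObjectProperty.singleton_iff _ _).2 rfl

lemma cell_of_projective (P : ModuleCat.{u} R) [Module.Projective R P] [Module.Finite R P] (j : ℤ) :
    ((ringCollection R).shiftClosure ℤ).binaryProductsClosure.retractClosure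
      ((singleFunctor (ModuleCat.{u} R) j).obj P) := by
  obtain ⟨n, p, hp⟩ := Module.Finite.exists_fin' R P
  -- An idle extra coordinate makes the rank positive, as `binaryProductsClosure_single` requires.
  let p' : (Fin (n + 1) → R) →ₗ[R] P := p ∘ₗ LinearMap.funLeft R R Fin.succ
  have hp' : Function.Surjective p' :=
    hp.comp (LinearMap.funLeft_surjective_of_injective R R _ (Fin.succ_injective n))
  obtain ⟨s, hs⟩ := Module.projective_lifting_property p' LinearMap.id hp'
  let r : Retract P (ModuleCat.of R (Fin (n + 1) → R)) :=
    { i := ModuleCat.ofHom s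
      r := ModuleCat.ofHom p'
      retract := ModuleCat.hom_ext hs }
  exact ⟨_, binaryProductsClosure_single j n _ (LinearEquiv.refl R _),
    ⟨r.map (singleFunctor (ModuleCat.{u} R) j)⟩⟩

lemma triangEnvelopeIter_of_isStrictly (m : ℕ) (a : ℤ) (K : CochainComplex (ModuleCat.{u} R) ℤ)
    [K.IsStrictlyGE a] [K.IsStrictlyLE (a + m)]
    (hK : ∀ i, Module.Projective R (K.X i) ∧ Module.Finite R (K.X i)) :
    (ringCollection R).triangEnvelopeIter m (Q.obj K) := by
  induction m generalizing K with
  | zero =>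
    have : K.IsStrictlyLE a := by simpa using ‹K.IsStrictlyLE (a + (0 : ℕ))›
    obtain ⟨M, ⟨e⟩⟩ := CochainComplex.exists_iso_single K a
    let e' : K.X a ≅ M := (HomologicalComplex.eval (ModuleCat.{u} R) (ComplexShape.up ℤ) a).mapIso e ≪≫
      HomologicalComplex.singleObjXSelf (ComplexShape.up ℤ) a M
    have := (hK a).1
    have := (hK a).2
    have : Module.Projective R M := .of_equiv e'.toLinearEquiv
    have : Module.Finite R M := .equiv e'.toLinearEquiv
    rw [triangEnvelopeIter_zero]
    exact prop_of_iso _ ((singleFunctorIsoCompQ (ModuleCat.{u} R) a).app M ≪≫ Q.mapIso e.symm)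
      (cell_of_projective M a)
  | succ m ih =>
    have : K.IsStrictlyLE (a + m + 1) := by simpa [add_assoc] using ‹K.IsStrictlyLE (a + (m + 1 : ℕ))›
    obtain ⟨L, f, g, w, hS, hL, hL', hLX⟩ := exists_shortExact_single K a (a + m)
    rw [triangEnvelopeIter_succ]
    refine le_retractClosure _ _ ⟨_, _, _, _, _, triangleOfSES_distinguished hS, ?_, ?_⟩
    · have := (hK (a + m + 1)).1
      have := (hK (a + m + 1)).2
      exact prop_of_iso _ ((singleFunctorIsoCompQ (ModuleCat.{u} R) (a + m + 1)).app
        (K.X (a + m + 1))) (cell_of_projective (K.X (a + m + 1)) (a + m + 1))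
    · refine ih L fun i => ?_
      obtain h | ⟨⟨e⟩⟩ := hLX i
      · have : Subsingleton (L.X i) := ModuleCat.subsingleton_of_isZero h
        exact ⟨inferInstance, inferInstance⟩
      · have := (hK i).1
        have := (hK i).2
        exact ⟨.of_equiv e.toLinearEquiv, .equiv e.toLinearEquiv⟩

end Cells

/-! ### Levels of the truncated resolution -/

section TruncatedResolutionLevel

open DerivedCategory Pretriangulated ObjectProperty

lemma triangEnvelopeIter_zero_shift {T : Type*} [Category* T] [HasZeroObject T] [HasShift T ℤ]
    [Preadditive T] [∀ n : ℤ, (shiftFunctor T n).Additive] [Pretriangulated T]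
    {C : ObjectProperty T} {M : T} (h : C M) (j : ℤ) : C.triangEnvelopeIter 0 (M⟦j⟧) := by
  rw [triangEnvelopeIter_zero]
  exact le_retractClosure _ _ (limitsClosure.of_mem _ ⟨M, j, Iso.refl _, h⟩)

variable {R : Type u} [CommRing R] {S : ℕ → ModuleCat.{u} R} (E : ∀ i, FreeExtension (S (i + 1)) (S i)) (n : ℕ)

lemma truncatedResolution_projective_finite (i : ℤ) :
    Module.Projective R ((truncatedResolution (freeResolution S E) n).X i) ∧
      Module.Finite R ((truncatedResolution (freeResolution S E) n).X i) := by
  by_cases h : -(n : ℤ) ≤ i ∧ i ≤ 0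
  · let e := truncatedResolutionXIso (freeResolution S E) n i.natAbs (by lia) i (by lia)
    have := (E i.natAbs).free
    have := (E i.natAbs).finite
    have h₁ : Module.Projective R ((freeResolution S E).complex.X i.natAbs) :=
      inferInstanceAs (Module.Projective R (E i.natAbs).F)
    have h₂ : Module.Finite R ((freeResolution S E).complex.X i.natAbs) :=
      inferInstanceAs (Module.Finite R (E i.natAbs).F)
    exact ⟨.of_equiv e.toLinearEquiv.symm, .equiv e.toLinearEquiv.symm⟩
  · have h0 : IsZero ((truncatedResolution (freeResolution S E) n).X i) := by
      rw [not_and_or, not_le, not_le] at h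
      obtain h | h := h
      · exact CochainComplex.isZero_of_isStrictlyGE _ (-(n : ℤ)) i h
      · exact CochainComplex.isZero_of_isStrictlyLE _ 0 i h
    have := ModuleCat.subsingleton_of_isZero h0
    exact ⟨inferInstance, inferInstance⟩

variable [HasDerivedCategory.{w} (ModuleCat.{u} R)]

lemma isPerfectComplex_truncatedResolution :
    IsPerfectComplex (Q.obj (truncatedResolution (freeResolution S E) n)) :=
  ⟨_, -(n : ℤ), 0, inferInstance, inferInstance, truncatedResolution_projective_finite E n,
    ⟨Iso.refl _⟩⟩

lemma exists_distinguished_truncatedResolution (hn : 1 ≤ n) :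
    ∃ (f : ((singleFunctor (ModuleCat.{u} R) 0).obj (S (n + 1)))⟦(n : ℤ)⟧ ⟶
        Q.obj (truncatedResolution (freeResolution S E) n))
      (g : Q.obj (truncatedResolution (freeResolution S E) n) ⟶
        (singleFunctor (ModuleCat.{u} R) 0).obj (S 0))
      (h : (singleFunctor (ModuleCat.{u} R) 0).obj (S 0) ⟶
        (((singleFunctor (ModuleCat.{u} R) 0).obj (S (n + 1)))⟦(n : ℤ)⟧)⟦(1 : ℤ)⟧),
      Triangle.mk f g h ∈ distTriang _ := by
  obtain ⟨m, rfl⟩ : ∃ m, n = m + 1 := ⟨n - 1, by lia⟩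
  obtain ⟨f, g, h, hT⟩ := exists_distinguished_of_exactAt
    (truncatedResolution (freeResolution S E) (m + 1)) (m + 1) hn (fun i hi hi' =>
      truncatedResolution_exactAt _ _ (-i - 1).toNat (by lia) i (by lia))
  obtain ⟨e₀⟩ := nonempty_truncatedResolution_homology_zero_iso (freeResolution S E) (m + 1) hn
  obtain ⟨e₁⟩ := nonempty_truncatedResolution_homology_neg_iso (freeResolution S E) (m + 1) m rfl
  have : Mono (E m).ι := (E m).shortExact.mono_f
  have : Mono (ShortComplex.mk _ _ (E (m + 1)).zero).f := (E (m + 1)).shortExact.mono_f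
  let e₂ : kernel ((freeResolution S E).complex.d (m + 1) m) ≅ S (m + 1 + 1) :=
    (kernelIsoOfEq (freeComplex_d S E m)) ≪≫ kernelCompMono (E (m + 1)).π (E m).ι ≪≫
      ((E (m + 1)).shortExact.fIsKernel.conePointUniqueUpToIso (kernelIsKernel _)).symm
  exact ⟨_, _, _, distinguished_of_iso hT
    ((shiftFunctor _ _).mapIso ((singleFunctor (ModuleCat.{u} R) 0).mapIso (e₁ ≪≫ e₂)))
    ((singleFunctor (ModuleCat.{u} R) 0).mapIso e₀)⟩

lemma level_gorenstein_le (hn : 1 ≤ n) (hS : ∀ i, VanishingExt (S i))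
    (hR : LocallyExtTorsion (ModuleCat.of R R)) [IsNoetherianRing R] :
    level (gorensteinProjectiveCollection R)
      (Q.obj (truncatedResolution (freeResolution S E) n)) ≤ 2 := by
  have hC : ∀ i, gorensteinProjectiveCollection R
      ((singleFunctor (ModuleCat.{u} R) 0).obj (S i)) := fun i =>
    ⟨S i, (hS i).finite, (hS i).isGorensteinProjective hR, ⟨Iso.refl _⟩⟩
  obtain ⟨f, g, h, hT⟩ := exists_distinguished_truncatedResolution E n hn
  refine level_le_of_triangEnvelopeIter (n := 1) ?_
  rw [triangEnvelopeIter_succ]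
  refine le_retractClosure _ _ ⟨_, _, f, g, h, hT, ?_, ?_⟩
  · simpa using! triangEnvelopeIter_zero_shift (hC (n + 1)) (n : ℤ)
  · exact le_triangEnvelopeIter _ 0 _ (hC 0)

lemma level_ring_le : level (ringCollection R)
    (Q.obj (truncatedResolution (freeResolution S E) n)) ≤ (n : ℕ∞) + 1 := by
  have : (truncatedResolution (freeResolution S E) n).IsStrictlyLE (-(n : ℤ) + n) := by
    rw [neg_add_cancel]
    infer_instance
  exact_mod_cast level_le_of_triangEnvelopeIter (triangEnvelopeIter_of_isStrictly n (-(n : ℤ))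
    (truncatedResolution (freeResolution S E) n) (truncatedResolution_projective_finite E n))

/-- The composite of `P ⟶ S 0` with the Yoneda product is a composite through `n` ghosts, so its
non-vanishing excludes level at most `n`. -/
lemma le_level_ring (hn : 1 ≤ n) (hS : VanishingExt (S 0)) (hS' : ¬ Projective (S 0)) :
    (n : ℕ∞) + 1 ≤ level (ringCollection R)
      (Q.obj (truncatedResolution (freeResolution S E) n)) := by
  obtain ⟨f, g, h, hT⟩ := exists_distinguished_truncatedResolution E n hn
  have hne : g ≫ (yonedaProduct E n).hom ≠ 0 := fun h0 => by
    obtain ⟨φ, hφ⟩ := Triangle.yoneda_exact₃ _ hT _ h0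
    -- `φ` goes from `S (n + 1)⟦n + 1⟧` to `S n⟦n⟧`, so it has negative degree.
    have hφ0 : φ = 0 := by
      let e := (shiftFunctorAdd' (DerivedCategory (ModuleCat.{u} R)) (n : ℤ) 1 ((n : ℤ) + 1) rfl).app
        ((singleFunctor (ModuleCat.{u} R) 0).obj (S (n + 1)))
      have := eq_zero_of_shift_of_lt ((n : ℤ) + 1) (n : ℤ) (by lia) (e.hom ≫ φ)
      exact (cancel_epi e.hom).1 (this.trans comp_zero.symm)
    rw [hφ0] at hφ
    refine yonedaProduct_ne_zero E hS hS' n (Ext.ext ?_)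
    rw [Ext.zero_hom]
    exact hφ.trans comp_zero
  obtain ⟨n, rfl⟩ : ∃ m, n = m + 1 := ⟨n - 1, by lia⟩
  have hiter : ¬ (ringCollection R).triangEnvelopeIter n
      (Q.obj (truncatedResolution (freeResolution S E) (n + 1))) := fun hm =>
    hne (eq_zero_of_triangEnvelopeIter
      (fun i => extShiftHom (E i).shortExact.extClass i) (fun i => isGhost_extShiftHom _ i) n hm
      (fun i => g ≫ (yonedaProduct E i).hom)
      (fun i => by rw [Category.assoc, hom_comp_extShiftHom]; rfl))
  have hP : ¬ IsZero (Q.obj (truncatedResolution (freeResolution S E) (n + 1))) :=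
    fun h => hne (h.eq_of_src _ _)
  have := le_level_of_not_triangEnvelopeIter hP hiter
  exact_mod_cast this

end TruncatedResolutionLevel

theorem mainTheorem7 (R : Type u) [CommRing R] [HasDerivedCategory.{w} (ModuleCat.{u} R)]
    (hG : IsGorensteinRing R) (hreg : ¬ IsRegularRing R) (n : ℕ) (hn : 2 ≤ n) :
    ∃ P : DerivedCategory (ModuleCat.{u} R),
      IsPerfectComplex P ∧
      level (ringCollection R) P = (n : ℕ∞) + 1 ∧
      level (gorensteinProjectiveCollection R) P ≤ 2 ∧
      ∃ (G : ModuleCat.{u} R) (F : ProjectiveResolution G),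
        Module.Finite R G ∧ IsGorensteinProjective G ∧ ¬ Module.Projective R G ∧
        (∀ i, Module.Free R (F.complex.X i) ∧ Module.Finite R (F.complex.X i)) ∧
        Nonempty (P ≅ DerivedCategory.Q.obj (truncatedResolution F n)) := by
  have hR := LocallyExtTorsion.of_isGorensteinRing hG
  obtain ⟨S, hE, hS, hS'⟩ := exists_nonprojective_vanishingExt_syzygies hG hreg
  let E := fun i => (hE i).some
  refine ⟨DerivedCategory.Q.obj (truncatedResolution (freeResolution S E) n),
    isPerfectComplex_truncatedResolution E n,
    le_antisymm (level_ring_le E n) (le_level_ring E n (by lia) (hS 0) (hS' 0)),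
    level_gorenstein_le E n (by lia) hS hR, S 0, freeResolution S E, (hS 0).finite,
    (hS 0).isGorensteinProjective hR, fun h => hS' 0 ((IsProjective.iff_projective (S 0)).1 h),
    fun i => ⟨(E i).free, (E i).finite⟩, ⟨Iso.refl _⟩⟩
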